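/- Fix an integer $k\ge 2$ and $\delta\in(0,1/k)$. A Markov chain over $[k]=\{1,\dots,k\}$ is given by an initial distribution $\mu$ and a transition matrix $M$. Let $\mathbb{M}^k_\delta$ be the set of all chains with $M_{ij}\ge\delta$ for all $i,j$ ($\mu$ arbitrary), and let $\pi$ denote the stationary distribution of a chain. An estimator $\hat M$ maps every sequence $x^n\in[k]^n$ to a transition matrix $\hat M_{x^n}$ over $[k]\times[k]$. For the loss $L_2(p,q)=\sum_{j}(p_j-q_j)^2$ put $$\varepsilon_n(M,\hat M)=\max_{i\in[k]}\mathbb{E}\big[L_2(M(i,\cdot),\hat M_{X^n}(i,\cdot))\big],\qquad \tilde\varepsilon_n(M,\hat M)=\sum_{i\in[k]}\pi_i\,\mathbb{E}\big[L_2(M(i,\cdot),\hat M_{X^n}(i,\cdot))\big],$$ where $X^n$ is a sample of length $n$ from the chain, and let $\varepsilon_n(\mathbb{M}^k_\delta)=\inf_{\hat M}\sup_{\mathbb{M}^k_\delta}\varepsilon_n(M,\hat M)$ and $\tilde\varepsilon_n(\mathbb{M}^k_\delta)=\inf_{\hat M}\sup_{\mathbb{M}^k_\delta}\tilde\varepsilon_n(M,\hat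 M)$ be the minimax risks. Write $a_n\lesssim b_n$ if $a_n\le b_n(1+o(1))$ as $n\to\infty$ (with $k,\delta$ fixed), and $a_n\asymp b_n$ if $a_n\lesssim b_n$ and $b_n\lesssim a_n$. Then $$\tilde\varepsilon_n(\mathbb{M}^k_\delta)\asymp\frac{k-1}{n}\qquad\text{and}\qquad (1-\delta)^2\,\frac{1-\frac1{k-1}}{n\delta}\lesssim\varepsilon_n(\mathbb{M}^k_\delta)\lesssim\frac{1-\frac1k}{n\delta}.$$ Moreover, both upper bounds are attained by the add-$\sqrt{N_i}/k$ estimator $$\hat M_{x^n}(i,j)=\frac{N_{ij}+\sqrt{N_i}/k}{N_i+\sqrt{N_i}},$$ where $N_{ij}$ is the number of times $j$ appears right after $i$ in $x^n$, $N_i$ is the number of times $i$ appears in $x^{n-1}$, and a row with $N_i=0$ is set to the uniform distribution: its worst-case risks over $\mathbb{M}^k_\delta$ satisfy $\sup_{\mathbb{M}^k_\delta}\tilde\varepsilon_n(M,\hat M)\lesssim\frac{k-1}{n}$ and $\sup_{\mathbb{M}^k_\delta}\varepsilon_n(M,\hat M)\lesssim\frac{1-1/k}{n\delta}$. -/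

import Mathlib

open Filter Topology

/-- A transition matrix over `k` states: every row is a probability distribution. -/
abbrev TransitionMatrix (k : ℕ) : Type := Fin k → stdSimplex ℝ (Fin k)

/-- A (time-homogeneous) Markov chain over `k` states: an initial distribution `μ` and a
transition matrix `M`. -/
structure MarkovChain (k : ℕ) where
  /-- the initial distribution -/
  init : stdSimplex ℝ (Fin k)
  /-- the transition matrix -/
  trans : TransitionMatrix k

/-- The chains all of whose transition probabilities are at least `δ`; the initial distribution
is arbitrary. -/
def chainsAbove (k : ℕ) (δ : ℝ) : Set (MarkovChain k) :=
  {C | ∀ i j, δ ≤ C.trans i j}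

/-- The probability that the first `n` observations of the chain are `x 0, …, x (n - 1)`. -/
noncomputable def MarkovChain.pathProb {k : ℕ} (C : MarkovChain k) :
    {n : ℕ} → (Fin n → Fin k) → ℝ
  | 0, _ => 1
  | m + 1, x => C.init (x 0) * ∏ t : Fin m, C.trans (x t.castSucc) (x t.succ)

/-- `p` is stationary for the transition matrix `M`, that is `p M = p`. -/
def IsStationaryFor {k : ℕ} (M : TransitionMatrix k) (p : stdSimplex ℝ (Fin k)) : Prop :=
  ∀ j, ∑ i, p i * M i j = p j

open Classical in
/-- A stationary distribution `π` of the chain. A chain on a finite nonempty state space has one,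
and it is unique when all transition probabilities are positive. -/
noncomputable def MarkovChain.stationary {k : ℕ} (C : MarkovChain k) : Fin k → ℝ :=
  if h : ∃ p : stdSimplex ℝ (Fin k), IsStationaryFor C.trans p then h.choose else 0

/-- The squared Euclidean loss between two distributions. -/
noncomputable def lossL2 {k : ℕ} (p q : stdSimplex ℝ (Fin k)) : ℝ :=
  ∑ j, (p j - q j) ^ 2

/-- An estimator from samples of length `n`: it maps every sequence to a transition matrix. -/
abbrev Estimator (k n : ℕ) : Type := (Fin n → Fin k) → TransitionMatrix k

/-- The expected loss in row `i`, for a sample of length `n` from the chain `C`. -/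
noncomputable def stateRisk {k n : ℕ} (C : MarkovChain k) (E : Estimator k n) (i : Fin k) : ℝ :=
  ∑ x : Fin n → Fin k, C.pathProb x * lossL2 (C.trans i) (E x i)

/-- The estimation risk: the largest expected loss over the states. -/
noncomputable def maxRisk {k n : ℕ} (C : MarkovChain k) (E : Estimator k n) : ℝ :=
  ⨆ i : Fin k, stateRisk C E i

/-- The alternative estimation risk: the average of the expected losses over the states,
weighted by the stationary distribution. -/
noncomputable def weightedRisk {k n : ℕ} (C : MarkovChain k) (E : Estimator k n) : ℝ :=
  ∑ i : Fin k, C.stationary i * stateRisk C E i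

/-- The worst-case risk of an estimator over a class of chains. (The risks used here take values
in `[0, 2]`, so this is a supremum of a bounded family.) -/
noncomputable def worstCaseRisk {k n : ℕ} (R : MarkovChain k → Estimator k n → ℝ)
    (S : Set (MarkovChain k)) (E : Estimator k n) : ℝ :=
  ⨆ C : S, R C E

/-- The minimax risk over a class of chains, for samples of length `n`. -/
noncomputable def minimaxRisk {k n : ℕ} (R : MarkovChain k → Estimator k n → ℝ)
    (S : Set (MarkovChain k)) : ℝ :=
  ⨅ E : Estimator k n, worstCaseRisk R S E

/-- `N_i`: the number of times `i` appears among the first `n - 1` entries of `x`. -/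
def visits {k : ℕ} : {n : ℕ} → (Fin n → Fin k) → Fin k → ℕ
  | 0, _, _ => 0
  | m + 1, x, i => (Finset.univ.filter fun t : Fin m => x t.castSucc = i).card

/-- `N_ij`: the number of times `j` appears right after `i` in `x`. -/
def transitions {k : ℕ} : {n : ℕ} → (Fin n → Fin k) → Fin k → Fin k → ℕ
  | 0, _, _, _ => 0
  | m + 1, x, i, j =>
    (Finset.univ.filter fun t : Fin m => x t.castSucc = i ∧ x t.succ = j).card

theorem sum_transitions {k n : ℕ} (x : Fin n → Fin k) (i : Fin k) :
    ∑ j, transitions x i j = visits x i := by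
  cases n with
  | zero => simp [transitions, visits]
  | succ m =>
    simp only [transitions, visits]
    rw [Finset.card_eq_sum_card_fiberwise (f := fun t : Fin m => x t.succ)
      (t := Finset.univ) (by intro t _; simp)]
    simp [Finset.filter_filter]

/-- The entries of the estimator obtained by adding `√N_i / k` to every count in row `i`;
a row whose state has not been visited (where the formula reads `0 / 0`) is uniform. -/
noncomputable def addSqrtEntry {k n : ℕ} (x : Fin n → Fin k) (i j : Fin k) : ℝ :=
  if visits x i = 0 then 1 / (k : ℝ)
  else ((transitions x i j : ℝ) + √(visits x i : ℝ) / k) / ((visits x i : ℝ) + √(visits x i : ℝ))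

theorem addSqrtEntry_mem {k n : ℕ} (x : Fin n → Fin k) (i : Fin k) :
    addSqrtEntry x i ∈ stdSimplex ℝ (Fin k) := by
  have hk : (k : ℝ) ≠ 0 := by
    have : 0 < k := i.pos
    positivity
  refine ⟨fun j => ?_, ?_⟩
  · unfold addSqrtEntry
    split_ifs <;> positivity
  · unfold addSqrtEntry
    split_ifs with h
    · simp [hk]
    · have hv : 0 < (visits x i : ℝ) := by exact_mod_cast Nat.pos_of_ne_zero h
      have hs : ∑ j, (transitions x i j : ℝ) = visits x i := by
        exact_mod_cast sum_transitions x i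
      rw [← Finset.sum_div, Finset.sum_add_distrib, hs]
      simp only [Finset.sum_const, Finset.card_univ, Fintype.card_fin, nsmul_eq_mul]
      rw [mul_div_cancel₀ _ hk]
      exact div_self (by positivity)

/-- The add-`√N_i / k` estimator. -/
noncomputable def addSqrtEstimator (k n : ℕ) : Estimator k n :=
  fun x i => ⟨addSqrtEntry x i, addSqrtEntry_mem x i⟩

/-- `a ≲ b`: `a n ≤ b n (1 + o(1))` as `n → ∞`. -/
def AsympLE (a b : ℕ → ℝ) : Prop :=
  ∃ e : ℕ → ℝ, Tendsto e atTop (𝓝 0) ∧ ∀ᶠ n in atTop, a n ≤ b n * (1 + e n)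

/-- `a ≍ b`: both `a ≲ b` and `b ≲ a`. -/
def AsympEq (a b : ℕ → ℝ) : Prop :=
  AsympLE a b ∧ AsympLE b a

/-!
Upper bounds. Let `S_j = N_ij - N_i p_j` be the transition counts out of `i`, centred under the row
`p = M i`. They are martingales in time with `E S_j² = p_j (1 - p_j) E N_i`. The loss of the
estimator in row `i` is `∑ j, (S_j + √N_i (1 / k - p_j))² / (N_i + √N_i)²`. Once `N_i` is replaced
by its mean `n π_i`, the numerator has expectation `n π_i (1 - ∑ j, p_j²)` (variance) plus
`n π_i (∑ j, p_j² - 1 / k)` (squared bias): the weight `√N_i` makes the sum independent of `p`, and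
the risk is about `(1 - 1 / k) / (n π_i)`. The replacement is justified by the Azuma–Hoeffding
inequality for the Doob martingale of `N_i`, whose increments have range at most `1 / δ`.

Lower bounds. Perturb the rows of a chain with independent rows of law `q` in all directions of
mass zero supported on a set `T` of columns, with coefficients drawn from a product prior on a small
cube. The van Trees inequality, applied to one coefficient at a time, bounds the Bayes risk of
row `i` below by about `(|T| - 1) b / (n q_i)` when `q ≥ b` on `T`. The stationary-weighted risk
takes `q` uniform and `T` everything. The worst-state risk takes `q` with mass `δ` at a state `i₀`
and `(1 - δ) / (k - 1)` elsewhere, and leaves the column of `i₀` untouched so that all entries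
stay at least `δ`.
-/

section WeightedMean

variable {ι : Type*} [Fintype ι] {p f : ι → ℝ} {c : ℝ}

theorem sum_mul_const_of_mem_stdSimplex (hp : p ∈ stdSimplex ℝ ι) (c : ℝ) :
    ∑ a, p a * c = c := by
  rw [← Finset.sum_mul, hp.2, one_mul]

theorem sum_mul_le_sum_mul_of_mem_stdSimplex {g : ι → ℝ} (hp : p ∈ stdSimplex ℝ ι)
    (hfg : ∀ a, f a ≤ g a) : ∑ a, p a * f a ≤ ∑ a, p a * g a :=
  Finset.sum_le_sum fun a _ => mul_le_mul_of_nonneg_left (hfg a) (hp.1 a)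

theorem sum_mul_le_of_mem_stdSimplex (hp : p ∈ stdSimplex ℝ ι) (hf : ∀ a, f a ≤ c) :
    ∑ a, p a * f a ≤ c :=
  (sum_mul_le_sum_mul_of_mem_stdSimplex hp hf).trans_eq (sum_mul_const_of_mem_stdSimplex hp c)

theorem le_sum_mul_of_mem_stdSimplex (hp : p ∈ stdSimplex ℝ ι) (hf : ∀ a, c ≤ f a) :
    c ≤ ∑ a, p a * f a :=
  (sum_mul_const_of_mem_stdSimplex hp c).symm.trans_le (sum_mul_le_sum_mul_of_mem_stdSimplex hp hf)

end WeightedMean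

section PathMean

variable {α : Type*} {m : ℕ} {q : α → ℝ} {M : α → α → ℝ}

/-- The weight of a path under the initial weights `q` and the transition weights `M`. They are
arbitrary real functions, so that paths can be weighted along perturbations of a chain. -/
def pathWeight (q : α → ℝ) (M : α → α → ℝ) {m : ℕ} (x : Fin (m + 1) → α) : ℝ :=
  q (x 0) * ∏ t : Fin m, M (x t.castSucc) (x t.succ)

/-- The expectation of a function of the path of length `m + 1`, under the weights
`pathWeight q M`. -/
def pathMean [Fintype α] (q : α → ℝ) (M : α → α → ℝ) {m : ℕ} (F : (Fin (m + 1) → α) → ℝ) : ℝ :=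
  ∑ x, pathWeight q M x * F x

/-- `q` and `M` are the initial distribution and the transition matrix of a Markov chain. -/
structure IsChainLaw [Fintype α] (q : α → ℝ) (M : α → α → ℝ) : Prop where
  init_mem : q ∈ stdSimplex ℝ α
  row_mem : ∀ a, M a ∈ stdSimplex ℝ α

/-- The path `x` followed by the state `y`; paths are analysed by removing their last state. -/
abbrev appendState (x : Fin (m + 1) → α) (y : α) : Fin (m + 2) → α :=
  Fin.snoc (α := fun _ => α) x y

theorem appendState_castSucc (x : Fin (m + 1) → α) (y : α) (t : Fin (m + 1)) :
    appendState x y t.castSucc = x t :=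
  Fin.snoc_castSucc (α := fun _ => α) y x t

theorem appendState_last (x : Fin (m + 1) → α) (y : α) :
    appendState x y (Fin.last (m + 1)) = y :=
  Fin.snoc_last (α := fun _ => α) y x

theorem pathWeight_appendState (x : Fin (m + 1) → α) (y : α) :
    pathWeight q M (appendState x y) = pathWeight q M x * M (x (Fin.last m)) y := by
  unfold pathWeight
  rw [Fin.prod_univ_castSucc, ← Fin.castSucc_zero, mul_assoc]
  simp only [appendState_castSucc, Fin.succ_last, appendState_last, Fin.succ_castSucc]

variable [Fintype α]

theorem pathMean_zero (F : (Fin 1 → α) → ℝ) :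
    pathMean q M F = ∑ a, q a * F (fun _ => a) := by
  unfold pathMean pathWeight
  rw [← (Equiv.funUnique (Fin 1) α).symm.sum_comp]
  refine Finset.sum_congr rfl fun a _ => ?_
  have const : (Equiv.funUnique (Fin 1) α).symm a = fun _ => a :=
    (Equiv.symm_apply_eq _).2 rfl
  simp [const]

theorem pathMean_succ (F : (Fin (m + 2) → α) → ℝ) :
    pathMean q M F =
      pathMean q M fun x => ∑ y, M (x (Fin.last m)) y * F (appendState x y) := by
  unfold pathMean
  rw [← (Fin.snocEquiv (fun _ => α)).sum_comp, Fintype.sum_prod_type, Finset.sum_comm]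
  refine Finset.sum_congr rfl fun x _ => ?_
  rw [Finset.mul_sum]
  refine Finset.sum_congr rfl fun y _ => ?_
  rw [← mul_assoc, ← pathWeight_appendState]
  rfl

theorem pathMean_add (F G : (Fin (m + 1) → α) → ℝ) :
    (pathMean q M fun x => F x + G x) = pathMean q M F + pathMean q M G := by
  simp only [pathMean, mul_add, Finset.sum_add_distrib]

theorem pathMean_const_mul (c : ℝ) (F : (Fin (m + 1) → α) → ℝ) :
    (pathMean q M fun x => c * F x) = c * pathMean q M F := by
  simp only [pathMean, Finset.mul_sum, mul_left_comm]

theorem pathMean_sum {ι : Type*} (s : Finset ι) (F : ι → (Fin (m + 1) → α) → ℝ) :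
    (pathMean q M fun x => ∑ j ∈ s, F j x) = ∑ j ∈ s, pathMean q M (F j) := by
  simp only [pathMean, Finset.mul_sum]
  exact Finset.sum_comm

namespace IsChainLaw

theorem pathWeight_mem (h : IsChainLaw q M) :
    (pathWeight q M : (Fin (m + 1) → α) → ℝ) ∈ stdSimplex ℝ (Fin (m + 1) → α) := by
  refine ⟨fun x => mul_nonneg (h.init_mem.1 _) (Finset.prod_nonneg fun _ _ => (h.row_mem _).1 _),
    ?_⟩
  suffices pathMean q M (fun _ : Fin (m + 1) → α => 1) = 1 by simpa [pathMean] using this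
  induction m with
  | zero => simp [pathMean_zero, h.init_mem.2]
  | succ m ih => simpa [pathMean_succ, (h.row_mem _).2] using ih

theorem pathMean_const (h : IsChainLaw q M) (c : ℝ) :
    (pathMean q M fun _ : Fin (m + 1) → α => c) = c :=
  sum_mul_const_of_mem_stdSimplex h.pathWeight_mem c

theorem pathMean_mono (h : IsChainLaw q M) {F G : (Fin (m + 1) → α) → ℝ}
    (hFG : ∀ x, F x ≤ G x) : pathMean q M F ≤ pathMean q M G :=
  sum_mul_le_sum_mul_of_mem_stdSimplex h.pathWeight_mem hFG

theorem pathMean_nonneg (h : IsChainLaw q M) {F : (Fin (m + 1) → α) → ℝ} (hF : ∀ x, 0 ≤ F x) :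
    0 ≤ pathMean q M F :=
  Finset.sum_nonneg fun x _ => mul_nonneg (h.pathWeight_mem.1 x) (hF x)

theorem pathMean_last_le (h : IsChainLaw q M) {f : α → ℝ} {β : ℝ} (hq : ∑ a, q a * f a ≤ β)
    (hM : ∀ a, ∑ b, M a b * f b ≤ β) :
    (pathMean q M fun x : Fin (m + 1) → α => f (x (Fin.last m))) ≤ β := by
  cases m with
  | zero => simpa [pathMean_zero] using hq
  | succ m =>
    rw [pathMean_succ]
    simp only [appendState_last]
    exact sum_mul_le_of_mem_stdSimplex h.pathWeight_mem fun x => hM _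

end IsChainLaw

end PathMean

section SuccessorSum

variable {α : Type*} [DecidableEq α] {m : ℕ} {q : α → ℝ} {M : α → α → ℝ} {i : α} {g : α → ℝ}

/-- The sum of `g` over the states that follow a visit to `i` along the path `x`. For `g = 1`
this is the number of visits to `i` before the last time. -/
def successorSum (i : α) (g : α → ℝ) (x : Fin (m + 1) → α) : ℝ :=
  ∑ t : Fin m, if x t.castSucc = i then g (x t.succ) else 0

theorem successorSum_singleton (x : Fin 1 → α) : successorSum i g x = 0 :=
  Fin.sum_univ_zero _

theorem successorSum_appendState (x : Fin (m + 1) → α) (y : α) :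
    successorSum i g (appendState x y) =
      successorSum i g x + if x (Fin.last m) = i then g y else 0 := by
  simp only [successorSum, Fin.sum_univ_castSucc, appendState_castSucc, Fin.succ_castSucc,
    Fin.succ_last, appendState_last]

variable [Fintype α]

theorem pathMean_succ_successorSum_one (h : IsChainLaw q M) :
    pathMean q M (fun x : Fin (m + 2) → α => successorSum i 1 x) =
      pathMean q M (fun x : Fin (m + 1) → α => successorSum i 1 x) +
        pathMean q M (fun x : Fin (m + 1) → α => if x (Fin.last m) = i then 1 else 0) := by
  rw [pathMean_succ, ← pathMean_add]
  simp only [successorSum_appendState, Pi.one_apply, sum_mul_const_of_mem_stdSimplex (h.row_mem _)]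

theorem pathMean_successorSum (h : IsChainLaw q M) :
    pathMean q M (fun x : Fin (m + 1) → α => successorSum i g x) =
      (∑ l, M i l * g l) * pathMean q M (fun x : Fin (m + 1) → α => successorSum i 1 x) := by
  induction m with
  | zero => simp [pathMean_zero, successorSum_singleton]
  | succ m ih =>
    have step : ∀ x : Fin (m + 1) → α,
        ∑ y, M (x (Fin.last m)) y * successorSum i g (appendState x y) =
          successorSum i g x +
            (∑ l, M i l * g l) * if x (Fin.last m) = i then 1 else 0 := by
      intro x
      simp only [successorSum_appendState, mul_add, Finset.sum_add_distrib,
        sum_mul_const_of_mem_stdSimplex (h.row_mem _)]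
      by_cases hx : x (Fin.last m) = i <;> simp [hx]
    rw [pathMean_succ_successorSum_one h, pathMean_succ, mul_add, ← ih, ← pathMean_const_mul,
      ← pathMean_add]
    exact congrArg _ (funext step)

/-- Centred successor sums are martingales, hence the absence of cross terms. -/
theorem pathMean_successorSum_sq (h : IsChainLaw q M) (hg : ∑ l, M i l * g l = 0) :
    pathMean q M (fun x : Fin (m + 1) → α => successorSum i g x ^ 2) =
      (∑ l, M i l * g l ^ 2) *
        pathMean q M (fun x : Fin (m + 1) → α => successorSum i 1 x) := by
  induction m with
  | zero => simp [pathMean_zero, successorSum_singleton]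
  | succ m ih =>
    have step : ∀ x : Fin (m + 1) → α,
        ∑ y, M (x (Fin.last m)) y * successorSum i g (appendState x y) ^ 2 =
          successorSum i g x ^ 2 +
            (∑ l, M i l * g l ^ 2) * if x (Fin.last m) = i then 1 else 0 := by
      intro x
      by_cases hx : x (Fin.last m) = i
      · have expand : ∀ y, M i y * (successorSum i g x + g y) ^ 2 =
            M i y * successorSum i g x ^ 2 + 2 * successorSum i g x * (M i y * g y) +
              M i y * g y ^ 2 := fun y => by ring
        simp only [successorSum_appendState, hx, if_true, mul_one, expand, Finset.sum_add_distrib,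
          ← Finset.mul_sum, hg, sum_mul_const_of_mem_stdSimplex (h.row_mem i), mul_zero, add_zero]
      · simp [successorSum_appendState, hx, sum_mul_const_of_mem_stdSimplex (h.row_mem _)]
    rw [pathMean_succ_successorSum_one h, pathMean_succ, mul_add, ← ih, ← pathMean_const_mul,
      ← pathMean_add]
    exact congrArg _ (funext step)

theorem pathMean_successorSum_one_le (h : IsChainLaw q M) {β : ℝ} (hq : q i ≤ β)
    (hM : ∀ a, M a i ≤ β) :
    pathMean q M (fun x : Fin (m + 1) → α => successorSum i 1 x) ≤ m * β := by
  induction m with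
  | zero => simp [pathMean_zero, successorSum_singleton]
  | succ m ih =>
    have last_le : pathMean q M (fun x : Fin (m + 1) → α =>
        if x (Fin.last m) = i then (1 : ℝ) else 0) ≤ β :=
      h.pathMean_last_le (f := fun a => if a = i then 1 else 0) (by simpa using hq)
        fun a => by simpa using hM a
    rw [pathMean_succ_successorSum_one h]
    push_cast
    linarith

end SuccessorSum

section Occupation

variable {α : Type*} [Fintype α] [DecidableEq α] {m : ℕ} {q : α → ℝ} {M : α → α → ℝ} {i : α}
  {δ : ℝ}

/-- The expected number of visits to `i` among the first `t` states of a path that starts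
at `a`. -/
noncomputable def occupation (M : α → α → ℝ) (i : α) : ℕ → α → ℝ
  | 0, _ => 0
  | t + 1, a => (if a = i then 1 else 0) + ∑ b, M a b * occupation M i t b

theorem pathMean_successorSum_one_add_occupation (h : IsChainLaw q M) (t : ℕ) :
    pathMean q M (fun x : Fin (m + 1) → α =>
      successorSum i 1 x + occupation M i t (x (Fin.last m))) =
      ∑ a, q a * occupation M i (t + m) a := by
  induction m generalizing t with
  | zero => simp [pathMean_zero, successorSum_singleton]
  | succ m ih =>
    rw [pathMean_succ, show t + (m + 1) = t + 1 + m by ring, ← ih (t + 1)]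
    congr 1
    funext x
    simp only [successorSum_appendState, appendState_last, mul_add, Finset.sum_add_distrib,
      sum_mul_const_of_mem_stdSimplex (h.row_mem _), occupation, Pi.one_apply, add_assoc]

/-- One step of the chain contracts the range of a function by the factor `1 - δ`, and `1 / δ` is
the fixed point of `c ↦ 1 + (1 - δ) c`. -/
theorem exists_occupation_mem_Icc (hM : ∀ a, M a ∈ stdSimplex ℝ α) (hδ : 0 < δ)
    (hMδ : ∀ a b, δ ≤ M a b) (i : α) (t : ℕ) :
    ∃ lo, ∀ a, occupation M i t a ∈ Set.Icc lo (lo + 1 / δ) := by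
  induction t with
  | zero => exact ⟨0, fun _ => by simp [occupation, hδ.le]⟩
  | succ t ih =>
    obtain ⟨lo, hlo⟩ := ih
    set D : α → ℝ := fun b => occupation M i t b - lo with hD
    have excess_nonneg : ∀ a b, 0 ≤ M a b - δ := fun a b => sub_nonneg.2 (hMδ a b)
    have decomp : ∀ a, ∑ b, M a b * occupation M i t b =
        lo + δ * ∑ b, D b + ∑ b, (M a b - δ) * D b := by
      intro a
      simp only [hD, sub_mul, mul_sub, Finset.sum_sub_distrib, ← Finset.mul_sum,
        sum_mul_const_of_mem_stdSimplex (hM a)]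
      ring
    have lower : ∀ a, 0 ≤ ∑ b, (M a b - δ) * D b := fun a =>
      Finset.sum_nonneg fun b _ => mul_nonneg (excess_nonneg a b) (sub_nonneg.2 (hlo b).1)
    have upper : ∀ a, ∑ b, (M a b - δ) * D b ≤ 1 / δ - 1 := by
      intro a
      have one_le_card : (1 : ℝ) ≤ Fintype.card α := by
        exact_mod_cast Fintype.card_pos_iff.2 ⟨i⟩
      calc ∑ b, (M a b - δ) * D b ≤ ∑ b, (M a b - δ) * (1 / δ) :=
            Finset.sum_le_sum fun b _ => mul_le_mul_of_nonneg_left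
              (sub_le_iff_le_add'.2 (hlo b).2) (excess_nonneg a b)
        _ = 1 / δ - Fintype.card α := by
            rw [← Finset.sum_mul, Finset.sum_sub_distrib, (hM a).2]
            simp only [Finset.sum_const, Finset.card_univ, nsmul_eq_mul]
            field_simp
        _ ≤ 1 / δ - 1 := by linarith
    refine ⟨lo + δ * ∑ b, D b, fun a => ?_⟩
    simp only [occupation, decomp]
    split_ifs <;> constructor <;> linarith [lower a, upper a]

end Occupation

section Concentration

variable {α : Type*} [Fintype α] {p : α → ℝ}

/-- Hoeffding's lemma for a finitely supported distribution. -/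
theorem sum_mul_exp_le_of_mem_Icc {U : α → ℝ} {lo c : ℝ} (hp : p ∈ stdSimplex ℝ α)
    (hU : ∀ a, U a ∈ Set.Icc lo (lo + c)) (s : ℝ) :
    ∑ a, p a * Real.exp (s * U a) ≤ Real.exp (s ^ 2 * c ^ 2 / 8 + s * ∑ a, p a * U a) := by
  let _ : MeasurableSpace α := ⊤
  let P : PMF α := PMF.ofFintype (fun a => ENNReal.ofReal (p a)) (by
    rw [← ENNReal.ofReal_sum_of_nonneg fun a _ => hp.1 a, hp.2, ENNReal.ofReal_one])
  have integral_eq : ∀ f : α → ℝ, ∫ a, f a ∂P.toMeasure = ∑ a, p a * f a := fun f => by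
    simp [P, PMF.integral_eq_sum, ENNReal.toReal_ofReal (hp.1 _)]
  have mgf_le := (ProbabilityTheory.hasSubgaussianMGF_of_mem_Icc (μ := P.toMeasure)
    (measurable_from_top (f := U)).aemeasurable (Filter.Eventually.of_forall hU)).mgf_le s
  rw [ProbabilityTheory.mgf, integral_eq, integral_eq, add_sub_cancel_left] at mgf_le
  calc ∑ a, p a * Real.exp (s * U a)
      = (∑ a, p a * Real.exp (s * (U a - ∑ b, p b * U b))) * Real.exp (s * ∑ b, p b * U b) := by
        rw [Finset.sum_mul]
        refine Finset.sum_congr rfl fun a _ => ?_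
        rw [mul_assoc, ← Real.exp_add]
        congr 2
        ring
    _ ≤ _ := by
        rw [Real.exp_add]
        gcongr
        refine mgf_le.trans_eq (congrArg _ ?_)
        simp only [NNReal.coe_pow, NNReal.coe_div, coe_nnnorm, NNReal.coe_ofNat, div_pow,
          Real.norm_eq_abs, sq_abs]
        ring

variable [DecidableEq α] {m : ℕ} {q : α → ℝ} {M : α → α → ℝ} {i : α} {δ : ℝ}

theorem pathMean_exp_successorSum_one_add_occupation_le (h : IsChainLaw q M) (hδ : 0 < δ)
    (hMδ : ∀ a b, δ ≤ M a b) (s : ℝ) (t : ℕ) :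
    pathMean q M (fun x : Fin (m + 1) → α =>
      Real.exp (s * (successorSum i 1 x + occupation M i t (x (Fin.last m))))) ≤
      Real.exp (m * (s ^ 2 * (1 / δ) ^ 2 / 8)) *
        ∑ a, q a * Real.exp (s * occupation M i (t + m) a) := by
  induction m generalizing t with
  | zero => simp [pathMean_zero, successorSum_singleton]
  | succ m ih =>
    obtain ⟨lo, hlo⟩ := exists_occupation_mem_Icc h.row_mem hδ hMδ i t
    have step : ∀ x : Fin (m + 1) → α, ∑ y, M (x (Fin.last m)) y * Real.exp (s *
        (successorSum i 1 (appendState x y) +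
          occupation M i t (appendState x y (Fin.last (m + 1))))) ≤
        Real.exp (s ^ 2 * (1 / δ) ^ 2 / 8) * Real.exp (s *
          (successorSum i 1 x + occupation M i (t + 1) (x (Fin.last m)))) := by
      intro x
      set a := x (Fin.last m)
      simp only [successorSum_appendState, appendState_last, Pi.one_apply]
      calc _ = Real.exp (s * (successorSum i 1 x + if a = i then 1 else 0)) *
            ∑ y, M a y * Real.exp (s * occupation M i t y) := by
            simp only [Finset.mul_sum, mul_add, Real.exp_add, mul_left_comm]
            rfl
        _ ≤ _ := mul_le_mul_of_nonneg_left
            (sum_mul_exp_le_of_mem_Icc (h.row_mem a) hlo s) (Real.exp_pos _).le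
        _ = _ := by
            rw [← Real.exp_add, ← Real.exp_add]
            simp only [occupation]
            congr 1
            ring
    rw [pathMean_succ]
    refine (h.pathMean_mono step).trans ?_
    rw [pathMean_const_mul]
    refine (mul_le_mul_of_nonneg_left (ih (t + 1)) (Real.exp_pos _).le).trans_eq ?_
    rw [← mul_assoc, ← Real.exp_add, add_right_comm t 1 m, ← add_assoc t m 1]
    congr 2
    push_cast
    ring

variable (hp : p ∈ stdSimplex ℝ α) (hpM : ∀ b, ∑ a, p a * M a b = p b)
include hpM

theorem sum_stationary_mul_occupation (t : ℕ) : ∑ a, p a * occupation M i t a = t * p i := by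
  induction t with
  | zero => simp [occupation]
  | succ t ih =>
    simp only [occupation, mul_add, Finset.sum_add_distrib, Finset.mul_sum]
    rw [Finset.sum_comm]
    simp only [← mul_assoc, ← Finset.sum_mul, hpM, ih, mul_ite, mul_one, mul_zero,
      Finset.sum_ite_eq', Finset.mem_univ, if_true]
    push_cast
    ring

include hp

theorem abs_occupation_sub_le (hM : ∀ a, M a ∈ stdSimplex ℝ α) (hδ : 0 < δ)
    (hMδ : ∀ a b, δ ≤ M a b) (t : ℕ) (a : α) : |occupation M i t a - t * p i| ≤ 1 / δ := by
  obtain ⟨lo, hlo⟩ := exists_occupation_mem_Icc hM hδ hMδ i t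
  have lo_le : lo ≤ t * p i := by
    rw [← sum_stationary_mul_occupation hpM]
    exact le_sum_mul_of_mem_stdSimplex hp fun b => (hlo b).1
  have le_hi : t * p i ≤ lo + 1 / δ := by
    rw [← sum_stationary_mul_occupation hpM]
    exact sum_mul_le_of_mem_stdSimplex hp fun b => (hlo b).2
  exact abs_le.2 ⟨by linarith [(hlo a).1], by linarith [(hlo a).2]⟩

theorem pathMean_successorSum_one_le_stationary (h : IsChainLaw q M) (hδ : 0 < δ)
    (hMδ : ∀ a b, δ ≤ M a b) :
    pathMean q M (fun x : Fin (m + 1) → α => successorSum i 1 x) ≤ m * p i + 1 / δ := by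
  have mean_eq := pathMean_successorSum_one_add_occupation (m := m) (i := i) h 0
  simp only [occupation, add_zero, zero_add] at mean_eq
  rw [mean_eq]
  exact sum_mul_le_of_mem_stdSimplex h.init_mem fun a =>
    sub_le_iff_le_add'.1 (abs_le.1 (abs_occupation_sub_le hp hpM h.row_mem hδ hMδ m a)).2

theorem pathMean_exp_successorSum_one_sub_le (h : IsChainLaw q M) (hδ : 0 < δ)
    (hMδ : ∀ a b, δ ≤ M a b) (s : ℝ) :
    pathMean q M (fun x : Fin (m + 1) → α => Real.exp (s * (successorSum i 1 x - m * p i))) ≤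
      Real.exp (m * (s ^ 2 * (1 / δ) ^ 2 / 8) + |s| * (1 / δ)) := by
  have mean_le := pathMean_exp_successorSum_one_add_occupation_le (m := m) (i := i) h hδ hMδ s 0
  simp only [occupation, add_zero, zero_add] at mean_le
  have init_le : ∑ a, q a * Real.exp (s * occupation M i m a) ≤
      Real.exp (s * (m * p i) + |s| * (1 / δ)) := by
    refine sum_mul_le_of_mem_stdSimplex h.init_mem fun a => Real.exp_le_exp.2 ?_
    have dev : |s * (occupation M i m a - m * p i)| ≤ |s| * (1 / δ) := by
      rw [abs_mul]
      exact mul_le_mul_of_nonneg_left (abs_occupation_sub_le hp hpM h.row_mem hδ hMδ m a)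
        (abs_nonneg s)
    linarith [(abs_le.1 dev).2]
  simp only [mul_sub, sub_eq_neg_add _ (s * (m * p i)), Real.exp_add (-(s * (m * p i))),
    pathMean_const_mul]
  calc _ ≤ Real.exp (-(s * (m * p i))) * (Real.exp (m * (s ^ 2 * (1 / δ) ^ 2 / 8)) *
        Real.exp (s * (m * p i) + |s| * (1 / δ))) := by
        gcongr
        exact mean_le.trans (mul_le_mul_of_nonneg_left init_le (Real.exp_pos _).le)
    _ = _ := by
        rw [← Real.exp_add, ← Real.exp_add]
        congr 1
        ring

/-- The exponent is the one given by Chernoff's method with the parameter `4 η δ²`. -/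
theorem pathMean_abs_successorSum_one_sub_gt_le (h : IsChainLaw q M) (hδ : 0 < δ)
    (hMδ : ∀ a b, δ ≤ M a b) {η : ℝ} (hη : 0 ≤ η) :
    pathMean q M (fun x : Fin (m + 1) → α =>
      if |successorSum i 1 x - m * p i| ≤ η * m then (0 : ℝ) else 1) ≤
      2 * Real.exp (4 * η * δ - m * (2 * η ^ 2 * δ ^ 2)) := by
  set s : ℝ := 4 * η * δ ^ 2 with hs
  have hs0 : 0 ≤ s := by positivity
  have chernoff : ∀ x : Fin (m + 1) → α,
      (if |successorSum i 1 x - m * p i| ≤ η * m then (0 : ℝ) else 1) ≤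
        Real.exp (-(s * (η * m))) * (Real.exp (s * (successorSum i 1 x - m * p i)) +
          Real.exp (-s * (successorSum i 1 x - m * p i))) := by
    intro x
    split_ifs with hx
    · positivity
    · rw [neg_mul]
      refine le_trans ?_ (mul_le_mul_of_nonneg_left (Real.exp_abs_le _) (Real.exp_pos _).le)
      rw [← Real.exp_add, abs_mul, abs_of_nonneg hs0, ← sub_eq_neg_add, ← mul_sub]
      exact Real.one_le_exp (mul_nonneg hs0 (sub_nonneg.2 (not_le.1 hx).le))
  have upper := pathMean_exp_successorSum_one_sub_le (m := m) (i := i) hp hpM h hδ hMδ s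
  have lower := pathMean_exp_successorSum_one_sub_le (m := m) (i := i) hp hpM h hδ hMδ (-s)
  rw [neg_sq, abs_neg] at lower
  refine (h.pathMean_mono chernoff).trans ?_
  rw [pathMean_const_mul, pathMean_add]
  refine (mul_le_mul_of_nonneg_left (add_le_add upper lower) (Real.exp_pos _).le).trans_eq ?_
  rw [← two_mul, mul_left_comm, ← Real.exp_add, abs_of_nonneg hs0, hs]
  congr 2
  field_simp
  ring

end Concentration

section Stationary

variable {α : Type*} [Fintype α] {M : α → α → ℝ}

theorem exists_ne_zero_sum_mul_eq [Nonempty α] (hM : ∀ a, ∑ b, M a b = 1) :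
    ∃ v : α → ℝ, v ≠ 0 ∧ ∀ b, ∑ a, v a * M a b = v b := by
  classical
  let A : Matrix α α ℝ := Matrix.of M
  have hdet : (A - 1).det = 0 := by
    refine Matrix.exists_mulVec_eq_zero_iff.1 ⟨1, one_ne_zero, ?_⟩
    rw [Matrix.sub_mulVec, Matrix.one_mulVec, sub_eq_zero]
    funext a
    simp [Matrix.mulVec, dotProduct, A, hM]
  obtain ⟨v, hv0, hv⟩ := Matrix.exists_vecMul_eq_zero_iff.2 hdet
  rw [Matrix.vecMul_sub, Matrix.vecMul_one, sub_eq_zero] at hv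
  exact ⟨v, hv0, fun b => by simpa [Matrix.vecMul, dotProduct, A] using congrFun hv b⟩

/-- `|v| ≤ |v| M` entrywise, and both sides have the same sum. -/
theorem sum_abs_mul_eq_abs (hM : ∀ a, M a ∈ stdSimplex ℝ α) {v : α → ℝ}
    (hv : ∀ b, ∑ a, v a * M a b = v b) (b : α) : ∑ a, |v a| * M a b = |v b| := by
  have hle : ∀ b ∈ Finset.univ, |v b| ≤ ∑ a, |v a| * M a b := fun b _ => by
    rw [← hv b]
    refine (Finset.abs_sum_le_sum_abs _ _).trans_eq (Finset.sum_congr rfl fun a _ => ?_)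
    rw [abs_mul, abs_of_nonneg ((hM a).1 b)]
  have htot : ∑ b, |v b| = ∑ b, ∑ a, |v a| * M a b := by
    rw [Finset.sum_comm]
    simp only [← Finset.mul_sum, (hM _).2, mul_one]
  exact ((Finset.sum_eq_sum_iff_of_le hle).1 htot b (Finset.mem_univ b)).symm

theorem exists_mem_stdSimplex_sum_mul_eq [Nonempty α] (hM : ∀ a, M a ∈ stdSimplex ℝ α) :
    ∃ p ∈ stdSimplex ℝ α, ∀ b, ∑ a, p a * M a b = p b := by
  obtain ⟨v, hv0, hv⟩ := exists_ne_zero_sum_mul_eq fun a => (hM a).2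
  have hpos : 0 < ∑ b, |v b| := by
    obtain ⟨b, hb⟩ := Function.ne_iff.1 hv0
    exact Finset.sum_pos' (fun _ _ => abs_nonneg _) ⟨b, Finset.mem_univ b, abs_pos.2 hb⟩
  refine ⟨fun b => |v b| / ∑ a, |v a|, ⟨fun b => by positivity, ?_⟩, fun b => ?_⟩
  · rw [← Finset.sum_div, div_self hpos.ne']
  · simp only [div_mul_eq_mul_div, ← Finset.sum_div, sum_abs_mul_eq_abs hM hv b]

variable {k : ℕ}

theorem MarkovChain.isChainLaw (C : MarkovChain k) :
    IsChainLaw C.init (fun a => C.trans a) where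
  init_mem := C.init.2
  row_mem a := (C.trans a).2

theorem MarkovChain.nonempty_state (C : MarkovChain k) : Nonempty (Fin k) := by
  by_contra empty
  rw [not_nonempty_iff] at empty
  simpa using stdSimplex.sum_eq_one C.init

theorem MarkovChain.stationary_spec (C : MarkovChain k) :
    C.stationary ∈ stdSimplex ℝ (Fin k) ∧
      ∀ b, ∑ a, C.stationary a * C.trans a b = C.stationary b := by
  have := C.nonempty_state
  obtain ⟨p, hp, hpM⟩ := exists_mem_stdSimplex_sum_mul_eq fun a => (C.trans a).2
  have h : ∃ p : stdSimplex ℝ (Fin k), IsStationaryFor C.trans p := ⟨⟨p, hp⟩, hpM⟩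
  rw [MarkovChain.stationary, dif_pos h]
  exact ⟨h.choose.2, h.choose_spec⟩

theorem MarkovChain.le_stationary (C : MarkovChain k) {δ : ℝ} {j : Fin k}
    (hC : ∀ i, δ ≤ C.trans i j) : δ ≤ C.stationary j := by
  obtain ⟨hp, hpM⟩ := C.stationary_spec
  rw [← hpM]
  exact le_sum_mul_of_mem_stdSimplex hp hC

end Stationary

section CentredCount

variable {α : Type*} [DecidableEq α] {m : ℕ} {q : α → ℝ} {M : α → α → ℝ}

/-- The number `N_ij - N_i p_j` of transitions from `i` to `j` along a path, centred under the
row `p` of transition probabilities out of `i`. -/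
def centredCount (p : α → ℝ) (i j : α) (x : Fin (m + 1) → α) : ℝ :=
  successorSum i (fun l => (if l = j then 1 else 0) - p j) x

theorem pathMean_centredCount_add_sq [Fintype α] (h : IsChainLaw q M) (i j : α) (c : ℝ) :
    pathMean q M (fun x : Fin (m + 1) → α => (centredCount (M i) i j x + c) ^ 2) =
      (M i j - M i j ^ 2) * pathMean q M (fun x : Fin (m + 1) → α => successorSum i 1 x) +
        c ^ 2 := by
  have mean_zero : ∑ l, M i l * ((if l = j then 1 else 0) - M i j) = 0 := by
    simp [mul_sub, sum_mul_const_of_mem_stdSimplex (h.row_mem i)]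
  have variance : ∑ l, M i l * ((if l = j then 1 else 0) - M i j) ^ 2 = M i j - M i j ^ 2 := by
    simp only [sub_sq, mul_add, mul_sub, Finset.sum_add_distrib, Finset.sum_sub_distrib,
      sum_mul_const_of_mem_stdSimplex (h.row_mem i)]
    simp only [ite_pow, one_pow, ne_eq, OfNat.ofNat_ne_zero, not_false_eq_true, zero_pow, mul_ite,
      mul_one, mul_zero, Finset.sum_ite_eq', Finset.mem_univ, if_true, ite_mul, zero_mul]
    ring
  have expand : ∀ x : Fin (m + 1) → α, (centredCount (M i) i j x + c) ^ 2 =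
      centredCount (M i) i j x ^ 2 + (2 * c * centredCount (M i) i j x + c ^ 2) := fun x => by
    ring
  have first_moment : pathMean q M (centredCount (M i) i j : (Fin (m + 1) → α) → ℝ) = 0 := by
    unfold centredCount
    rw [pathMean_successorSum h, mean_zero, zero_mul]
  have second_moment := pathMean_successorSum_sq (m := m) h mean_zero
  rw [variance] at second_moment
  simp only [expand, pathMean_add, pathMean_const_mul, h.pathMean_const, first_moment, mul_zero,
    zero_add]
  rw [← second_moment]
  rfl

variable {k : ℕ}

theorem visits_eq_successorSum (x : Fin (m + 1) → Fin k) (i : Fin k) :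
    (visits x i : ℝ) = successorSum i 1 x := by
  simp only [visits, successorSum, Finset.card_filter, Nat.cast_sum, Nat.cast_ite, Nat.cast_one,
    Nat.cast_zero, Pi.one_apply]

theorem centredCount_eq (p : Fin k → ℝ) (i j : Fin k) (x : Fin (m + 1) → Fin k) :
    centredCount p i j x = transitions x i j - visits x i * p j := by
  simp only [centredCount, successorSum, transitions, visits, Finset.card_filter, Nat.cast_sum,
    Finset.sum_mul, ← Finset.sum_sub_distrib]
  refine Finset.sum_congr rfl fun t _ => ?_
  by_cases ht : x t.castSucc = i <;> simp [ht]

end CentredCount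

section AddSqrt

variable {k m : ℕ}

theorem lossL2_nonneg (p q : stdSimplex ℝ (Fin k)) : 0 ≤ lossL2 p q :=
  Finset.sum_nonneg fun _ _ => sq_nonneg _

theorem sum_sq_le_one (p : stdSimplex ℝ (Fin k)) : ∑ j, p j ^ 2 ≤ 1 := by
  rw [← stdSimplex.sum_eq_one p]
  exact Finset.sum_le_sum fun j _ => pow_le_of_le_one (stdSimplex.zero_le p j)
    (stdSimplex.le_one p j) two_ne_zero

theorem lossL2_le_two (p q : stdSimplex ℝ (Fin k)) : lossL2 p q ≤ 2 := by
  calc lossL2 p q ≤ ∑ j, (p j ^ 2 + q j ^ 2) := Finset.sum_le_sum fun j _ => by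
        nlinarith [mul_nonneg (stdSimplex.zero_le p j) (stdSimplex.zero_le q j)]
    _ ≤ 2 := by
        rw [Finset.sum_add_distrib]
        linarith [sum_sq_le_one p, sum_sq_le_one q]

theorem sum_sq_uniform_sub (p : stdSimplex ℝ (Fin k)) :
    ∑ j, (1 / (k : ℝ) - p j) ^ 2 = ∑ j, p j ^ 2 - 1 / k := by
  rcases Nat.eq_zero_or_pos k with rfl | hk
  · simp
  · simp only [sub_sq, Finset.sum_add_distrib, Finset.sum_sub_distrib, ← Finset.mul_sum,
      stdSimplex.sum_eq_one p, Finset.sum_const, Finset.card_univ, Fintype.card_fin, nsmul_eq_mul]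
    field_simp
    ring

theorem sq_sqrt_sub_sqrt_le {N μ ε : ℝ} (hN : 0 ≤ N) (hμ : 0 < μ) (h : |N - μ| ≤ ε * μ) :
    (√N - √μ) ^ 2 ≤ ε ^ 2 * μ := by
  have factor : (√N - √μ) * (√N + √μ) = N - μ := by
    linear_combination Real.sq_sqrt hN - Real.sq_sqrt hμ.le
  refine le_of_mul_le_mul_right ?_ hμ
  calc (√N - √μ) ^ 2 * μ = (√N - √μ) ^ 2 * √μ ^ 2 := by rw [Real.sq_sqrt hμ.le]
    _ ≤ (√N - √μ) ^ 2 * (√N + √μ) ^ 2 := by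
        gcongr
        linarith [Real.sqrt_nonneg N]
    _ = |N - μ| ^ 2 := by rw [← mul_pow, factor, sq_abs]
    _ ≤ (ε * μ) ^ 2 := by gcongr
    _ = ε ^ 2 * μ * μ := by ring

theorem sub_addSqrtEntry (p : Fin k → ℝ) (i j : Fin k) (x : Fin (m + 1) → Fin k)
    (hx : visits x i ≠ 0) : p j - addSqrtEntry x i j =
      -(centredCount p i j x + √(visits x i) * (1 / k - p j)) / (visits x i + √(visits x i)) := by
  have hk : (k : ℝ) ≠ 0 := Nat.cast_ne_zero.2 i.pos.ne'
  have : (0 : ℝ) < visits x i := Nat.cast_pos.2 (Nat.pos_of_ne_zero hx)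
  rw [addSqrtEntry, if_neg hx, centredCount_eq]
  field_simp
  ring

/-- The second factor replaces `√N_i` by the deterministic `√μ`, which makes its expectation
explicit. -/
theorem lossL2_addSqrtEstimator_le (p : stdSimplex ℝ (Fin k)) (i : Fin k) {μ ε : ℝ} (hμ : 0 < μ)
    (hε : 0 < ε) (hε' : ε < 1) (x : Fin (m + 1) → Fin k)
    (hN : |(visits x i : ℝ) - μ| ≤ ε * μ) :
    lossL2 p (addSqrtEstimator k (m + 1) x i) ≤ (1 + ε) / ((1 - ε) * μ) ^ 2 *
      ∑ j, ((centredCount p i j x + √μ * (1 / k - p j)) ^ 2 + ε * μ * (1 / k - p j) ^ 2) := by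
  have hNlo : (1 - ε) * μ ≤ visits x i := by linarith [(abs_le.1 hN).1]
  have hpos : 0 < (1 - ε) * μ := mul_pos (sub_pos.2 hε') hμ
  have hN0 : (0 : ℝ) < visits x i := hpos.trans_le hNlo
  rw [lossL2, Finset.mul_sum]
  refine Finset.sum_le_sum fun j _ => ?_
  change (p j - addSqrtEntry x i j) ^ 2 ≤ _
  rw [sub_addSqrtEntry p i j x (Nat.cast_ne_zero.1 hN0.ne'), div_pow, neg_sq]
  set S := centredCount p i j x
  set N : ℝ := (visits x i : ℝ)
  set a := 1 / (k : ℝ) - p j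
  have numerator : (S + √N * a) ^ 2 ≤ (1 + ε) * ((S + √μ * a) ^ 2 + ε * μ * a ^ 2) := by
    have young : (S + √N * a) ^ 2 ≤
        (1 + ε) * ((S + √μ * a) ^ 2 + ((√N - √μ) * a) ^ 2 / ε) := by
      have := two_mul_le_add_sq (ε * (S + √μ * a)) ((√N - √μ) * a)
      field_simp
      nlinarith
    have root : ((√N - √μ) * a) ^ 2 / ε ≤ ε * μ * a ^ 2 := by
      rw [mul_pow, div_le_iff₀ hε]
      nlinarith [mul_le_mul_of_nonneg_right (sq_sqrt_sub_sqrt_le hN0.le hμ hN) (sq_nonneg a)]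
    exact young.trans (by gcongr)
  calc (S + √N * a) ^ 2 / (N + √N) ^ 2 ≤ (S + √N * a) ^ 2 / ((1 - ε) * μ) ^ 2 := by
        gcongr
        linarith [Real.sqrt_nonneg N]
    _ ≤ _ := by
        rw [div_mul_eq_mul_div]
        gcongr

theorem pathMean_sum_centredCount_add_sq_le (C : MarkovChain k) (i : Fin k) {μ c ε : ℝ}
    (hμ : 0 ≤ μ) (hc : 0 ≤ c) (hε : 0 ≤ ε) (hN : pathMean C.init (fun a => C.trans a)
      (fun x : Fin (m + 1) → Fin k => successorSum i 1 x) ≤ μ + c) :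
    pathMean C.init (fun a => C.trans a) (fun x : Fin (m + 1) → Fin k =>
      ∑ j, ((centredCount (C.trans i) i j x + √μ * (1 / k - C.trans i j)) ^ 2 +
        ε * μ * (1 / k - C.trans i j) ^ 2)) ≤ (1 + ε) * (μ + c) * (1 - 1 / k) := by
  simp only [pathMean_sum, pathMean_add, C.isChainLaw.pathMean_const,
    pathMean_centredCount_add_sq C.isChainLaw, mul_pow, Real.sq_sqrt hμ, Finset.sum_add_distrib,
    ← Finset.mul_sum, ← Finset.sum_mul, Finset.sum_sub_distrib, stdSimplex.sum_eq_one,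
    sum_sq_uniform_sub]
  set V := ∑ j, C.trans i j ^ 2
  have hV : 0 ≤ 1 - V := sub_nonneg.2 (sum_sq_le_one _)
  have hB : 0 ≤ V - 1 / k := by
    rw [← sum_sq_uniform_sub]
    positivity
  nlinarith [mul_le_mul_of_nonneg_left hN hV, mul_nonneg (mul_nonneg hε (add_nonneg hμ hc)) hV,
    mul_nonneg (mul_nonneg (add_nonneg zero_le_one hε) hc) hB]

theorem stateRisk_addSqrtEstimator_le {δ : ℝ} (hδ : 0 < δ) {C : MarkovChain k}
    (hC : C ∈ chainsAbove k δ) (i : Fin k) {ε : ℝ} (hε : 0 < ε) (hε' : ε < 1) (hm : 0 < m) :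
    stateRisk C (addSqrtEstimator k (m + 1)) i ≤
      (1 + ε) / ((1 - ε) * (m * C.stationary i)) ^ 2 *
        ((1 + ε) * (m * C.stationary i + 1 / δ) * (1 - 1 / k)) +
      4 * Real.exp (4 * (ε * δ) * δ - m * (2 * (ε * δ) ^ 2 * δ ^ 2)) := by
  obtain ⟨hp, hpM⟩ := C.stationary_spec
  have hδμ : m * δ ≤ m * C.stationary i :=
    mul_le_mul_of_nonneg_left (C.le_stationary fun a => hC a i) m.cast_nonneg
  have hmδ : 0 < m * δ := by positivity
  have visits_le := pathMean_successorSum_one_le_stationary (m := m) (i := i) hp hpM C.isChainLaw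
    hδ hC
  have deviation_le := pathMean_abs_successorSum_one_sub_gt_le (m := m) (i := i) hp hpM
    C.isChainLaw hδ hC (mul_pos hε hδ).le
  set μ : ℝ := m * C.stationary i
  have hμ : 0 < μ := hmδ.trans_le hδμ
  have loss_le : ∀ x : Fin (m + 1) → Fin k,
      lossL2 (C.trans i) (addSqrtEstimator k (m + 1) x i) ≤ (1 + ε) / ((1 - ε) * μ) ^ 2 *
        ∑ j, ((centredCount (C.trans i) i j x + √μ * (1 / k - C.trans i j)) ^ 2 +
          ε * μ * (1 / k - C.trans i j) ^ 2) +
        2 * if |successorSum i 1 x - μ| ≤ ε * δ * m then 0 else 1 := by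
    intro x
    split_ifs with hx
    · rw [mul_zero, add_zero]
      refine lossL2_addSqrtEstimator_le _ i hμ hε hε' x ?_
      rw [visits_eq_successorSum]
      nlinarith
    · have main_nonneg : 0 ≤ (1 + ε) / ((1 - ε) * μ) ^ 2 *
          ∑ j, ((centredCount (C.trans i) i j x + √μ * (1 / k - C.trans i j)) ^ 2 +
            ε * μ * (1 / k - C.trans i j) ^ 2) := by positivity
      linarith [lossL2_le_two (C.trans i) (addSqrtEstimator k (m + 1) x i)]
  refine (C.isChainLaw.pathMean_mono loss_le).trans ?_
  rw [pathMean_add, pathMean_const_mul, pathMean_const_mul]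
  have main_le := pathMean_sum_centredCount_add_sq_le C i hμ.le (one_div_pos.2 hδ).le hε.le
    visits_le
  exact (add_le_add (mul_le_mul_of_nonneg_left main_le (by positivity))
    (mul_le_mul_of_nonneg_left deviation_le zero_le_two)).trans_eq (by ring)

theorem stationary_mul_stateRisk_addSqrtEstimator_le {δ : ℝ} (hδ : 0 < δ) {C : MarkovChain k}
    (hC : C ∈ chainsAbove k δ) (i : Fin k) {ε : ℝ} (hε : 0 < ε) (hε' : ε < 1) (hm : 0 < m) :
    C.stationary i * stateRisk C (addSqrtEstimator k (m + 1)) i ≤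
      (1 - 1 / k) * ((1 + ε) / (1 - ε)) ^ 2 * ((1 + 1 / δ ^ 2 / m) / m) +
        4 * Real.exp (4 * (ε * δ) * δ - m * (2 * (ε * δ) ^ 2 * δ ^ 2)) := by
  have hπ : δ ≤ C.stationary i := C.le_stationary fun a => hC a i
  have hπ1 : C.stationary i ≤ 1 := (mem_Icc_of_mem_stdSimplex (C.stationary_spec).1 i).2
  have hκ : 0 ≤ 1 - 1 / (k : ℝ) :=
    sub_nonneg.2 (div_le_one_of_le₀ (Nat.one_le_cast.2 i.pos) (Nat.cast_nonneg k))
  have risk_le := stateRisk_addSqrtEstimator_le hδ hC i hε hε' hm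
  set E := Real.exp (4 * (ε * δ) * δ - m * (2 * (ε * δ) ^ 2 * δ ^ 2))
  set π := C.stationary i
  have hπ0 : 0 < π := hδ.trans_le hπ
  have hε1 : 0 < 1 - ε := sub_pos.2 hε'
  have : (0 : ℝ) < m := Nat.cast_pos.2 hm
  calc π * stateRisk C (addSqrtEstimator k (m + 1)) i
      ≤ π * ((1 + ε) / ((1 - ε) * (m * π)) ^ 2 * ((1 + ε) * (m * π + 1 / δ) * (1 - 1 / k)) +
          4 * E) := mul_le_mul_of_nonneg_left risk_le hπ0.le
    _ = (1 - 1 / k) * ((1 + ε) / (1 - ε)) ^ 2 * ((1 + 1 / (δ * π) / m) / m) + π * (4 * E) := by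
        field_simp
    _ ≤ (1 - 1 / k) * ((1 + ε) / (1 - ε)) ^ 2 * ((1 + 1 / δ ^ 2 / m) / m) + 1 * (4 * E) := by
        gcongr
        nlinarith
    _ = _ := by rw [one_mul]

end AddSqrt

section UpperLimit

variable {k : ℕ}

theorem tendsto_add_one_mul_exp_sub_mul (a : ℝ) {b : ℝ} (hb : 0 < b) :
    Tendsto (fun m : ℕ => ((m : ℝ) + 1) * Real.exp (a - m * b)) atTop (𝓝 0) := by
  have hr : Real.exp (-b) < 1 := by simpa using hb
  have geom := ((tendsto_self_mul_const_pow_of_lt_one (Real.exp_pos _).le hr).add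
    (tendsto_pow_atTop_nhds_zero_of_lt_one (Real.exp_pos _).le hr)).const_mul (Real.exp a)
  rw [add_zero, mul_zero] at geom
  refine geom.congr fun m => ?_
  rw [sub_eq_add_neg, Real.exp_add, ← mul_neg, Real.exp_nat_mul]
  ring

theorem tendsto_add_one_mul_one_add_div_div (c : ℝ) :
    Tendsto (fun m : ℕ => ((m : ℝ) + 1) * ((1 + c / m) / m)) atTop (𝓝 1) := by
  have lim := (tendsto_const_div_atTop_nhds_zero_nat (1 : ℝ)).const_add 1 |>.mul
    ((tendsto_const_div_atTop_nhds_zero_nat c).const_add 1)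
  rw [add_zero, mul_one] at lim
  refine lim.congr' ?_
  filter_upwards [eventually_gt_atTop 0] with m hm
  field_simp

theorem exists_mul_sq_div_lt {κ c : ℝ} (hc : κ < c) :
    ∃ ε ∈ Set.Ioo (0 : ℝ) 1, κ * ((1 + ε) / (1 - ε)) ^ 2 < c := by
  have cont : ContinuousAt (fun ε : ℝ => κ * ((1 + ε) / (1 - ε)) ^ 2) 0 := by
    fun_prop (disch := norm_num)
  have small := (cont.eventually_lt_const (by simpa using hc)).filter_mono
    (nhdsWithin_le_nhds (s := Set.Ioi 0))
  obtain ⟨ε, hlt, hε⟩ := (small.and (Ioo_mem_nhdsGT (zero_lt_one' ℝ))).exists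
  exact ⟨ε, hε, hlt⟩

theorem eventually_stationary_mul_stateRisk_addSqrtEstimator_le {δ : ℝ} (hδ : 0 < δ) {c : ℝ}
    (hc : 1 - 1 / k < c) : ∀ᶠ n : ℕ in atTop, ∀ C ∈ chainsAbove k δ, ∀ i,
      C.stationary i * stateRisk C (addSqrtEstimator k n) i ≤ c / n := by
  obtain ⟨ε, ⟨hε, hε'⟩, hlt⟩ := exists_mul_sq_div_lt hc
  have hb : 0 < 2 * (ε * δ) ^ 2 * δ ^ 2 := by positivity
  have lim := ((tendsto_add_one_mul_one_add_div_div (1 / δ ^ 2)).const_mul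
    ((1 - 1 / (k : ℝ)) * ((1 + ε) / (1 - ε)) ^ 2)).add
      ((tendsto_add_one_mul_exp_sub_mul (4 * (ε * δ) * δ) hb).const_mul 4)
  rw [mul_one, mul_zero, add_zero] at lim
  rw [← map_add_atTop_eq_nat 1, eventually_map]
  filter_upwards [lim.eventually_lt_const hlt, eventually_gt_atTop 0] with m hlim hm C hC i
  have risk_le := stationary_mul_stateRisk_addSqrtEstimator_le hδ hC i hε hε' hm
  push_cast
  rw [le_div_iff₀ (by positivity), mul_comm]
  calc _ ≤ ((m : ℝ) + 1) * _ := mul_le_mul_of_nonneg_left risk_le (by positivity)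
    _ = _ := by ring
    _ ≤ c := hlim.le

end UpperLimit

section VanTrees

open MeasureTheory

variable {Ω : Type*} [Fintype Ω] {a b : ℝ} {p s : ℝ → Ω → ℝ} {ψ ψ' g g' : ℝ → ℝ} {I : ℝ}

theorem sum_mul_score_eq_zero (hp : ∀ t ∈ Set.Icc a b, p t ∈ stdSimplex ℝ Ω)
    (hs : ∀ t ∈ Set.Icc a b, ∀ x, HasDerivAt (fun t => p t x) (p t x * s t x) t) {t : ℝ}
    (ht : t ∈ Set.Ioo a b) : ∑ x, p t x * s t x = 0 := by
  have deriv_sum := HasDerivAt.fun_sum fun x (_ : x ∈ Finset.univ) =>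
    hs t (Set.Ioo_subset_Icc_self ht) x
  have sum_eq_one : (fun t => ∑ x, p t x) =ᶠ[𝓝 t] fun _ => 1 := by
    filter_upwards [Ioo_mem_nhds ht.1 ht.2] with u hu using (hp u (Set.Ioo_subset_Icc_self hu)).2
  exact deriv_sum.unique ((hasDerivAt_const t 1).congr_of_eventuallyEq sum_eq_one)

/-- Expand `0 ≤ E (f u - l (σ u + 2 v)) ^ 2`. -/
theorem two_mul_sum_le_of_mem_stdSimplex {p σ : Ω → ℝ} (hp : p ∈ stdSimplex ℝ Ω)
    (hσ : ∑ x, p x * σ x = 0) (hI : ∑ x, p x * σ x ^ 2 ≤ I) (f : Ω → ℝ) (u v l : ℝ) :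
    2 * l * (u ^ 2 * ∑ x, p x * σ x * f x + 2 * u * v * ∑ x, p x * f x) ≤
      u ^ 2 * ∑ x, p x * f x ^ 2 + l ^ 2 * (u ^ 2 * I + 4 * v ^ 2) := by
  have square_nonneg : 0 ≤ ∑ x, p x * (f x * u - l * (σ x * u + 2 * v)) ^ 2 :=
    Finset.sum_nonneg fun x _ => mul_nonneg (hp.1 x) (sq_nonneg _)
  have expand : ∑ x, p x * (f x * u - l * (σ x * u + 2 * v)) ^ 2 =
      u ^ 2 * ∑ x, p x * f x ^ 2 -
        2 * l * (u ^ 2 * ∑ x, p x * σ x * f x + 2 * u * v * ∑ x, p x * f x) +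
      l ^ 2 * (u ^ 2 * ∑ x, p x * σ x ^ 2 + 4 * u * v * ∑ x, p x * σ x + 4 * v ^ 2 * ∑ x, p x) := by
    simp only [Finset.mul_sum, ← Finset.sum_add_distrib, ← Finset.sum_sub_distrib]
    exact Finset.sum_congr rfl fun x _ => by ring
  rw [hσ, hp.2] at expand
  nlinarith [mul_le_mul_of_nonneg_left hI (mul_nonneg (sq_nonneg l) (sq_nonneg u))]

theorem hasDerivAt_sq_mul_sum {t : ℝ} (hp : p t ∈ stdSimplex ℝ Ω)
    (hs : ∀ x, HasDerivAt (fun t => p t x) (p t x * s t x) t) (hψ : HasDerivAt ψ (ψ' t) t)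
    (hg : HasDerivAt g (g' t) t) (e : Ω → ℝ) :
    HasDerivAt (fun t => g t ^ 2 * ∑ x, p t x * (e x - ψ t))
      (g t ^ 2 * ∑ x, p t x * s t x * (e x - ψ t) +
        2 * g t * g' t * ∑ x, p t x * (e x - ψ t) - g t ^ 2 * ψ' t) t := by
  refine ((hg.fun_pow 2).mul (HasDerivAt.fun_sum fun x (_ : x ∈ Finset.univ) =>
    (hs x).mul (hψ.const_sub (e x)))).congr_deriv ?_
  simp only [Pi.mul_apply, Finset.sum_add_distrib, mul_neg, Finset.sum_neg_distrib,
    sum_mul_const_of_mem_stdSimplex hp]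
  ring

variable (hab : a ≤ b) (hp : ∀ t ∈ Set.Icc a b, p t ∈ stdSimplex ℝ Ω)
  (hs : ∀ t ∈ Set.Icc a b, ∀ x, HasDerivAt (fun t => p t x) (p t x * s t x) t)
  (hI : ∀ t ∈ Set.Icc a b, ∑ x, p t x * s t x ^ 2 ≤ I)
  (hψ : ∀ t ∈ Set.Icc a b, HasDerivAt ψ (ψ' t) t) (hψ' : ContinuousOn ψ' (Set.Icc a b))
  (hg : ∀ t ∈ Set.Icc a b, HasDerivAt g (g' t) t) (hg' : ContinuousOn g' (Set.Icc a b))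
  (hga : g a = 0) (hgb : g b = 0) (hg1 : ∫ t in a..b, g t ^ 2 = 1)
include hab hp hs hI hψ hψ' hg hg' hga hgb hg1

theorem vanTrees_linear (e : Ω → ℝ) (l : ℝ) :
    2 * l * (∫ t in a..b, g t ^ 2 * ψ' t) - l ^ 2 * (I + 4 * ∫ t in a..b, g' t ^ 2) ≤
      ∫ t in a..b, g t ^ 2 * ∑ x, p t x * (e x - ψ t) ^ 2 := by
  have hpc : ∀ x, ContinuousOn (fun t => p t x) (Set.Icc a b) := fun x =>
    HasDerivAt.continuousOn fun t ht => hs t ht x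
  have hψc : ContinuousOn ψ (Set.Icc a b) := HasDerivAt.continuousOn hψ
  have hgc : ContinuousOn g (Set.Icc a b) := HasDerivAt.continuousOn hg
  have boundary := intervalIntegral.sub_le_integral_of_hasDeriv_right_of_le hab
    (g := fun t => 2 * l * (g t ^ 2 * ∑ x, p t x * (e x - ψ t)))
    (φ := fun t => g t ^ 2 * (∑ x, p t x * (e x - ψ t) ^ 2) +
      (l ^ 2 * (I * g t ^ 2 + 4 * g' t ^ 2) - 2 * l * (g t ^ 2 * ψ' t)))
    (by fun_prop)
    (fun t ht => by
      have ht' := Set.Ioo_subset_Icc_self ht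
      exact ((hasDerivAt_sq_mul_sum (hp t ht') (hs t ht') (hψ t ht') (hg t ht') e).const_mul
        (2 * l)).hasDerivWithinAt)
    (ContinuousOn.integrableOn_Icc (by fun_prop))
    (fun t ht => by
      have ht' := Set.Ioo_subset_Icc_self ht
      linarith [two_mul_sum_le_of_mem_stdSimplex (hp t ht') (sum_mul_score_eq_zero hp hs ht)
        (hI t ht') (fun x => e x - ψ t) (g t) (g' t) l])
  have int : ∀ {f : ℝ → ℝ}, ContinuousOn f (Set.Icc a b) → IntervalIntegrable f volume a b :=
    fun hf => hf.intervalIntegrable_of_Icc hab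
  rw [intervalIntegral.integral_add (int (by fun_prop)) (int (by fun_prop)),
    intervalIntegral.integral_sub (int (by fun_prop)) (int (by fun_prop)),
    intervalIntegral.integral_const_mul, intervalIntegral.integral_const_mul,
    intervalIntegral.integral_add (int (by fun_prop)) (int (by fun_prop)),
    intervalIntegral.integral_const_mul, intervalIntegral.integral_const_mul, hg1] at boundary
  simp only [hga, hgb] at boundary
  linarith

/-- The van Trees inequality (Bayesian Cramér–Rao bound) with the prior density `g ^ 2`, whose
Fisher information is the integral of `4 g' ^ 2`. -/
theorem vanTrees (e : Ω → ℝ) :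
    (∫ t in a..b, g t ^ 2 * ψ' t) ^ 2 / (I + 4 * ∫ t in a..b, g' t ^ 2) ≤
      ∫ t in a..b, g t ^ 2 * ∑ x, p t x * (e x - ψ t) ^ 2 := by
  refine le_of_eq_of_le ?_ (vanTrees_linear hab hp hs hI hψ hψ' hg hg' hga hgb hg1 e
    ((∫ t in a..b, g t ^ 2 * ψ' t) / (I + 4 * ∫ t in a..b, g' t ^ 2)))
  rcases eq_or_ne (I + 4 * ∫ t in a..b, g' t ^ 2) 0 with hD | hD
  · simp [hD]
  · field_simp
    ring

end VanTrees

section CosPrior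

open MeasureTheory

variable {r : ℝ}

/-- The square root of the density `cos² (π t / (2 r)) / r` on `[-r, r]`, which has the smallest
Fisher information among the densities supported there. -/
noncomputable def cosBump (r t : ℝ) : ℝ := √(1 / r) * Real.cos (Real.pi / (2 * r) * t)

theorem continuous_cosBump_sq (r : ℝ) : Continuous fun t => cosBump r t ^ 2 := by
  unfold cosBump
  fun_prop

theorem hasDerivAt_cosBump (r t : ℝ) : HasDerivAt (cosBump r)
    (-(√(1 / r) * (Real.pi / (2 * r)) * Real.sin (Real.pi / (2 * r) * t))) t := by
  have inner : HasDerivAt (fun t => Real.pi / (2 * r) * t) (Real.pi / (2 * r)) t := by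
    simpa using (hasDerivAt_id t).const_mul (Real.pi / (2 * r))
  exact (inner.cos.const_mul (√(1 / r))).congr_deriv (by ring)

theorem cosBump_self (hr : r ≠ 0) : cosBump r r = 0 := by
  rw [cosBump, show Real.pi / (2 * r) * r = Real.pi / 2 by field_simp, Real.cos_pi_div_two,
    mul_zero]

theorem cosBump_neg (r t : ℝ) : cosBump r (-t) = cosBump r t := by
  rw [cosBump, mul_neg, Real.cos_neg, cosBump]

theorem integral_cosBump_sq (hr : 0 < r) : ∫ t in -r..r, cosBump r t ^ 2 = 1 := by
  have endpoint : Real.pi / (2 * r) * r = Real.pi / 2 := by field_simp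
  simp only [cosBump, mul_pow, Real.sq_sqrt (one_div_pos.2 hr).le]
  rw [intervalIntegral.integral_const_mul,
    intervalIntegral.integral_comp_mul_left (fun t => Real.cos t ^ 2) (by positivity), mul_neg,
    endpoint, integral_cos_sq, Real.cos_neg, Real.cos_pi_div_two, smul_eq_mul]
  field_simp
  ring

theorem integral_deriv_cosBump_sq (hr : 0 < r) :
    4 * ∫ t in -r..r, (-(√(1 / r) * (Real.pi / (2 * r)) * Real.sin (Real.pi / (2 * r) * t))) ^ 2 =
      Real.pi ^ 2 / r ^ 2 := by
  have endpoint : Real.pi / (2 * r) * r = Real.pi / 2 := by field_simp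
  simp only [neg_sq, mul_pow, Real.sq_sqrt (one_div_pos.2 hr).le]
  rw [intervalIntegral.integral_const_mul,
    intervalIntegral.integral_comp_mul_left (fun t => Real.sin t ^ 2) (by positivity), mul_neg,
    endpoint, integral_sin_sq, Real.cos_neg, Real.cos_pi_div_two, smul_eq_mul]
  field_simp
  ring

/-- The probability measure on `[-r, r]` with density `cosBump r ^ 2`. -/
noncomputable def cosPrior (r : ℝ) : Measure ℝ :=
  (volume.restrict (Set.Icc (-r) r)).withDensity fun t => ENNReal.ofReal (cosBump r t ^ 2)

theorem integral_cosPrior (hr : 0 ≤ r) (f : ℝ → ℝ) :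
    ∫ t, f t ∂cosPrior r = ∫ t in -r..r, cosBump r t ^ 2 * f t := by
  unfold cosPrior
  rw [integral_withDensity_eq_integral_toReal_smul
    (continuous_cosBump_sq r).measurable.ennreal_ofReal (by simp),
    intervalIntegral.integral_of_le (by linarith), integral_Icc_eq_integral_Ioc]
  simp only [ENNReal.toReal_ofReal (sq_nonneg _), smul_eq_mul]

theorem isProbabilityMeasure_cosPrior (hr : 0 < r) : IsProbabilityMeasure (cosPrior r) := by
  refine ⟨?_⟩
  unfold cosPrior
  rw [withDensity_apply _ MeasurableSet.univ, Measure.restrict_univ,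
    ← ofReal_integral_eq_lintegral_ofReal (continuous_cosBump_sq r).integrableOn_Icc
      (ae_of_all _ fun _ => sq_nonneg _),
    integral_Icc_eq_integral_Ioc, ← intervalIntegral.integral_of_le (by linarith),
    integral_cosBump_sq hr, ENNReal.ofReal_one]

theorem ae_cosPrior_mem_Icc (r : ℝ) : ∀ᵐ t ∂cosPrior r, t ∈ Set.Icc (-r) r :=
  (withDensity_absolutelyContinuous _ _).ae_le (ae_restrict_mem measurableSet_Icc)

end CosPrior

section RowScore

variable {α : Type*} [DecidableEq α] {m : ℕ} {q : α → ℝ} {M : ℝ → α → α → ℝ} {i : α}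

theorem hasDerivAt_pathWeight {σ : α → ℝ} {t : ℝ}
    (hM : ∀ a b, HasDerivAt (fun t => M t a b) (M t a b * if a = i then σ b else 0) t)
    (x : Fin (m + 1) → α) :
    HasDerivAt (fun t => pathWeight q (M t) x)
      (pathWeight q (M t) x * successorSum i σ x) t := by
  refine ((HasDerivAt.fun_finsetProd fun s (_ : s ∈ Finset.univ) =>
    hM (x s.castSucc) (x s.succ)).const_mul (q (x 0))).congr_deriv ?_
  simp only [pathWeight, successorSum, mul_assoc, Finset.mul_sum]
  refine Finset.sum_congr rfl fun s hs => ?_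
  rw [← Finset.mul_prod_erase _ _ hs, smul_eq_mul]
  ring

theorem vanTrees_pathMean [Fintype α] {r d I : ℝ} (hr : 0 < r) {σ : ℝ → α → ℝ} {ψ : ℝ → ℝ}
    (hlaw : ∀ t ∈ Set.Icc (-r) r, IsChainLaw q (M t))
    (hM : ∀ t ∈ Set.Icc (-r) r, ∀ a b,
      HasDerivAt (fun t => M t a b) (M t a b * if a = i then σ t b else 0) t)
    (hσ : ∀ t ∈ Set.Icc (-r) r, ∑ l, M t i l * σ t l = 0)
    (hI : ∀ t ∈ Set.Icc (-r) r, (∑ l, M t i l * σ t l ^ 2) *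
      pathMean q (M t) (fun x : Fin (m + 1) → α => successorSum i 1 x) ≤ I)
    (hψ : ∀ t ∈ Set.Icc (-r) r, HasDerivAt ψ d t) (e : (Fin (m + 1) → α) → ℝ) :
    d ^ 2 / (I + Real.pi ^ 2 / r ^ 2) ≤
      ∫ t, pathMean q (M t) (fun x => (e x - ψ t) ^ 2) ∂cosPrior r := by
  have bound := vanTrees (p := fun t => pathWeight q (M t))
    (s := fun t => successorSum i (σ t)) (I := I) (ψ := ψ) (ψ' := fun _ => d) (g := cosBump r)
    (by linarith) (fun t ht => (hlaw t ht).pathWeight_mem)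
    (fun t ht x => hasDerivAt_pathWeight (hM t ht) x)
    (fun t ht => (pathMean_successorSum_sq (hlaw t ht) (hσ t ht)).trans_le (hI t ht))
    hψ continuousOn_const (fun t _ => hasDerivAt_cosBump r t) (by fun_prop)
    (by rw [cosBump_neg, cosBump_self hr.ne']) (cosBump_self hr.ne') (integral_cosBump_sq hr) e
  rw [intervalIntegral.integral_mul_const, integral_cosBump_sq hr, one_mul,
    integral_deriv_cosBump_sq hr] at bound
  rwa [integral_cosPrior hr.le]

end RowScore

section ProductPrior

open MeasureTheory

variable {ι : Type*} [Fintype ι] {X : ι → Type*} [∀ i, MeasurableSpace (X i)]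
  {ν : ∀ i, Measure (X i)} [∀ i, IsProbabilityMeasure (ν i)]

theorem ae_mem_univ_pi {S : ∀ i, Set (X i)} (hS : ∀ i, ∀ᵐ t ∂ν i, t ∈ S i) :
    ∀ᵐ θ ∂Measure.pi ν, θ ∈ Set.univ.pi S := by
  filter_upwards [ae_all_iff.2 fun i => Measure.tendsto_eval_ae_ae.eventually (hS i)]
    with θ hθ i _ using hθ i

variable [DecidableEq ι]

theorem measurePreserving_update (c : ι) :
    MeasurePreserving (fun p : (∀ i, X i) × X c => Function.update p.1 c p.2)
      ((Measure.pi ν).prod (ν c)) (Measure.pi ν) := by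
  have measurable : Measurable fun p : (∀ i, X i) × X c => Function.update p.1 c p.2 :=
    measurable_update'
  refine ⟨measurable, (Measure.pi_eq fun s hs => ?_).symm⟩
  have preimage : (fun p : (∀ i, X i) × X c => Function.update p.1 c p.2) ⁻¹' Set.univ.pi s =
      Set.univ.pi (Function.update s c Set.univ) ×ˢ s c := by
    ext p
    simp only [Set.mem_preimage, Set.mem_univ_pi, Set.mem_prod]
    rw [Function.forall_update_iff p.1 fun i y => y ∈ s i,
      Function.forall_update_iff s fun i u => p.1 i ∈ u]
    simp [and_comm]
  rw [Measure.map_apply measurable (MeasurableSet.univ_pi hs), preimage, Measure.prod_prod,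
    Measure.pi_pi, ← Finset.mul_prod_erase _ _ (Finset.mem_univ c),
    ← Finset.mul_prod_erase _ (fun i => ν i (s i)) (Finset.mem_univ c), Function.update_self,
    measure_univ, one_mul, mul_comm]
  refine congrArg _ (Finset.prod_congr rfl fun i hi => ?_)
  rw [Function.update_of_ne (Finset.ne_of_mem_erase hi)]

theorem le_integral_pi_of_forall_le_integral_update {S : ∀ i, Set (X i)}
    (hS : ∀ i, ∀ᵐ t ∂ν i, t ∈ S i) {f : (∀ i, X i) → ℝ} (hf : Integrable f (Measure.pi ν)) (c : ι)
    {κ : ℝ} (h : ∀ θ ∈ Set.univ.pi S, κ ≤ ∫ t, f (Function.update θ c t) ∂ν c) :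
    κ ≤ ∫ θ, f θ ∂Measure.pi ν := by
  have resample := measurePreserving_update (ν := ν) c
  have integrable_resampled : Integrable
      (fun p : (∀ i, X i) × X c => f (Function.update p.1 c p.2)) ((Measure.pi ν).prod (ν c)) :=
    resample.integrable_comp_of_integrable hf
  have integral_eq : ∫ θ, f θ ∂Measure.pi ν =
      ∫ p, f (Function.update p.1 c p.2) ∂(Measure.pi ν).prod (ν c) := by
    rw [← integral_map resample.measurable.aemeasurable (by
      rw [resample.map_eq]
      exact hf.aestronglyMeasurable), resample.map_eq]
  rw [integral_eq, integral_prod _ integrable_resampled]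
  calc κ = ∫ _, κ ∂Measure.pi ν := by simp
    _ ≤ _ := integral_mono_ae (integrable_const _) integrable_resampled.integral_prod_left <| by
        filter_upwards [ae_mem_univ_pi hS] with θ hθ using h θ hθ

theorem exists_mem_pi_sum_le {S : ∀ i, Set (X i)} (hS : ∀ i, ∀ᵐ t ∂ν i, t ∈ S i)
    (K : Finset ι) {R : ι → (∀ i, X i) → ℝ} (hR : ∀ c ∈ K, Integrable (R c) (Measure.pi ν))
    {κ : ι → ℝ} (h : ∀ c ∈ K, ∀ θ ∈ Set.univ.pi S, κ c ≤ ∫ t, R c (Function.update θ c t) ∂ν c) :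
    ∃ θ ∈ Set.univ.pi S, ∑ c ∈ K, κ c ≤ ∑ c ∈ K, R c θ := by
  obtain ⟨θ, hθ, hle⟩ := exists_notMem_null_integral_le (integrable_finsetSum K hR)
    (ae_iff.1 (ae_mem_univ_pi hS))
  refine ⟨θ, not_not.1 hθ, le_trans ?_ hle⟩
  rw [integral_finsetSum _ hR]
  exact Finset.sum_le_sum fun c hc => le_integral_pi_of_forall_le_integral_update hS (hR c hc) c
    (h c hc)

end ProductPrior

section CubePrior

open MeasureTheory

theorem exists_mem_Icc_sum_le_of_cosPrior {ι : Type*} [Finite ι] [DecidableEq ι] {r : ℝ}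
    (hr : 0 < r) (K : Finset ι) {R : ι → (ι → ℝ) → ℝ} (hR : ∀ c ∈ K, Continuous (R c))
    {κ : ι → ℝ}
    (h : ∀ c ∈ K, ∀ θ : ι → ℝ, (∀ i, θ i ∈ Set.Icc (-r) r) →
      κ c ≤ ∫ t, R c (Function.update θ c t) ∂cosPrior r) :
    ∃ θ : ι → ℝ, (∀ i, θ i ∈ Set.Icc (-r) r) ∧ ∑ c ∈ K, κ c ≤ ∑ c ∈ K, R c θ := by
  have := Fintype.ofFinite ι
  have := isProbabilityMeasure_cosPrior hr
  have mem_box : ∀ _ : ι, ∀ᵐ t ∂cosPrior r, t ∈ Set.Icc (-r) r := fun _ => ae_cosPrior_mem_Icc r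
  have integrable : ∀ c ∈ K, Integrable (R c) (Measure.pi fun _ => cosPrior r) := fun c hc => by
    rw [← Measure.restrict_eq_self_of_ae_mem (ae_mem_univ_pi mem_box)]
    exact (hR c hc).continuousOn.integrableOn_compact (isCompact_univ_pi fun _ => isCompact_Icc)
  simpa only [Set.mem_univ_pi] using exists_mem_pi_sum_le mem_box K integrable fun c hc θ hθ =>
    h c hc θ (Set.mem_univ_pi.1 hθ)

end CubePrior

section TiltedRows

variable {α : Type*} [DecidableEq α] {m : ℕ} {q : α → ℝ} {T : Finset α} {i j : α}
  {θ : α × α → ℝ} {r b : ℝ}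

/-- The indicator of `j` among the columns `T`, centred so that it sums to zero: the direction in
which a parameter of `tiltedRows` moves a row. -/
noncomputable def centredIndicator (T : Finset α) (j l : α) : ℝ :=
  if l ∈ T then (if l = j then 1 else 0) - 1 / (T.card : ℝ) else 0

/-- The matrix whose rows are the perturbations of `q` on the columns `T`, of total mass zero,
with the coefficients `θ`. -/
noncomputable def tiltedRows (q : α → ℝ) (T : Finset α) (θ : α × α → ℝ) (i j : α) : ℝ :=
  q j + ∑ l ∈ T, θ (i, l) * centredIndicator T l j

theorem centredIndicator_self (hj : j ∈ T) : centredIndicator T j j = 1 - 1 / (T.card : ℝ) := by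
  rw [centredIndicator, if_pos hj, if_pos rfl]

theorem tiltedRows_of_notMem (θ : α × α → ℝ) (i : α) (hj : j ∉ T) : tiltedRows q T θ i j = q j := by
  simp only [tiltedRows, centredIndicator, if_neg hj, mul_zero, Finset.sum_const_zero, add_zero]

theorem hasDerivAt_tiltedRows (θ : α × α → ℝ) (i : α) (hj : j ∈ T) (a l : α) (t : ℝ) :
    HasDerivAt (fun t => tiltedRows q T (Function.update θ (i, j) t) a l)
      (if a = i then centredIndicator T j l else 0) t := by
  have coordinate := hasDerivAt_pi.1 (hasDerivAt_update θ (i, j) t)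
  refine ((HasDerivAt.fun_sum fun s (_ : s ∈ T) =>
    (coordinate (a, s)).mul_const (centredIndicator T s l)).const_add (q l)).congr_deriv ?_
  by_cases ha : a = i
  · simp [Pi.single_apply, ha, hj]
  · simp [ha]

theorem continuous_tiltedRows (i j : α) : Continuous fun θ => tiltedRows q T θ i j := by
  unfold tiltedRows
  fun_prop

theorem continuous_pathMean_tiltedRows [Fintype α] (e : (Fin (m + 1) → α) → ℝ) (i j : α) :
    Continuous fun θ =>
      pathMean q (tiltedRows q T θ) fun x => (e x - tiltedRows q T θ i j) ^ 2 := by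
  have := continuous_tiltedRows (q := q) (T := T)
  unfold pathMean pathWeight
  fun_prop

theorem sum_abs_centredIndicator_le (T : Finset α) (j : α) :
    ∑ l ∈ T, |centredIndicator T l j| ≤ 2 := by
  by_cases hj : j ∈ T
  · have card_ne : (T.card : ℝ) ≠ 0 := by simpa using Finset.ne_empty_of_mem hj
    calc ∑ l ∈ T, |centredIndicator T l j|
        ≤ ∑ l ∈ T, ((if j = l then 1 else 0) + 1 / (T.card : ℝ)) := by
          refine Finset.sum_le_sum fun l _ => ?_
          rw [centredIndicator, if_pos hj]
          refine (abs_sub _ _).trans_eq ?_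
          rw [abs_of_nonneg (by positivity), abs_of_nonneg (by positivity)]
      _ = 2 := by
          rw [Finset.sum_add_distrib, Finset.sum_ite_eq, if_pos hj, Finset.sum_const, nsmul_eq_mul,
            mul_one_div_cancel card_ne]
          norm_num
  · simp [centredIndicator, hj]

theorem abs_tiltedRows_sub_le (hθ : ∀ c, θ c ∈ Set.Icc (-r) r) (i j : α) :
    |tiltedRows q T θ i j - q j| ≤ 2 * r := by
  have hr : 0 ≤ r := by linarith [(hθ (i, j)).1, (hθ (i, j)).2]
  calc |tiltedRows q T θ i j - q j| = |∑ l ∈ T, θ (i, l) * centredIndicator T l j| := by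
        rw [tiltedRows, add_sub_cancel_left]
    _ ≤ ∑ l ∈ T, r * |centredIndicator T l j| := by
        refine (Finset.abs_sum_le_sum_abs _ _).trans (Finset.sum_le_sum fun l _ => ?_)
        rw [abs_mul]
        exact mul_le_mul_of_nonneg_right (abs_le.2 (hθ _)) (abs_nonneg _)
    _ ≤ 2 * r := by
        rw [← Finset.mul_sum, mul_comm 2]
        exact mul_le_mul_of_nonneg_left (sum_abs_centredIndicator_le T j) hr

variable [Fintype α]

theorem sum_centredIndicator (hj : j ∈ T) : ∑ l, centredIndicator T j l = 0 := by
  have card_ne : (T.card : ℝ) ≠ 0 := by simpa using Finset.ne_empty_of_mem hj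
  simp only [centredIndicator, Finset.sum_ite_mem, Finset.univ_inter, Finset.sum_sub_distrib,
    Finset.sum_ite_eq', if_pos hj, Finset.sum_const, nsmul_eq_mul, mul_one_div_cancel card_ne,
    sub_self]

theorem sum_centredIndicator_sq (hj : j ∈ T) :
    ∑ l, centredIndicator T j l ^ 2 = 1 - 1 / (T.card : ℝ) := by
  have sq_eq : ∀ l, centredIndicator T j l ^ 2 =
      (if l = j then centredIndicator T j l else 0) - 1 / T.card * centredIndicator T j l := by
    intro l
    unfold centredIndicator
    split_ifs <;> ring
  simp only [sq_eq, Finset.sum_sub_distrib, ← Finset.mul_sum, sum_centredIndicator hj,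
    Finset.sum_ite_eq', Finset.mem_univ, if_true, mul_zero, sub_zero, centredIndicator_self hj]

theorem isChainLaw_tiltedRows (hq : ∑ j, q j = 1) (hqr : ∀ j, 2 * r < q j)
    (hθ : ∀ c, θ c ∈ Set.Icc (-r) r) : IsChainLaw q (tiltedRows q T θ) where
  init_mem := ⟨fun j => by
    linarith [hqr j, (abs_nonneg _).trans (abs_tiltedRows_sub_le (q := q) (T := T) hθ j j)], hq⟩
  row_mem i := by
    refine ⟨fun j => by
      linarith [hqr j, (abs_le.1 (abs_tiltedRows_sub_le (q := q) (T := T) hθ i j)).1], ?_⟩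
    simp only [tiltedRows, Finset.sum_add_distrib, hq]
    rw [Finset.sum_comm, Finset.sum_eq_zero fun l hl => ?_, add_zero]
    rw [← Finset.mul_sum, sum_centredIndicator hl, mul_zero]

theorem sum_mul_sq_centredIndicator_div_le {p : α → ℝ} (hb : 0 < b) (hp : ∀ l ∈ T, b ≤ p l)
    (hj : j ∈ T) :
    ∑ l, p l * (centredIndicator T j l / p l) ^ 2 ≤ (1 - 1 / (T.card : ℝ)) / b := by
  rw [← sum_centredIndicator_sq hj, Finset.sum_div]
  refine Finset.sum_le_sum fun l _ => ?_
  by_cases hl : l ∈ T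
  · have pos : 0 < p l := hb.trans_le (hp l hl)
    calc p l * (centredIndicator T j l / p l) ^ 2 = centredIndicator T j l ^ 2 / p l := by
          field_simp
      _ ≤ centredIndicator T j l ^ 2 / b :=
          div_le_div_of_nonneg_left (sq_nonneg _) hb (hp l hl)
  · simp [centredIndicator, hl]

theorem le_integral_pathMean_tiltedRows_update (hr : 0 < r) (hq : ∑ j, q j = 1)
    (hqr : ∀ j, 2 * r < q j) (hbr : 2 * r < b) (hb : ∀ l ∈ T, b ≤ q l)
    (hθ : ∀ c, θ c ∈ Set.Icc (-r) r) (i : α) (hj : j ∈ T) (e : (Fin (m + 1) → α) → ℝ) :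
    (1 - 1 / (T.card : ℝ)) ^ 2 /
        ((1 - 1 / (T.card : ℝ)) / (b - 2 * r) * (m * (q i + 2 * r)) + Real.pi ^ 2 / r ^ 2) ≤
      ∫ t, pathMean q (tiltedRows q T (Function.update θ (i, j) t))
        (fun x => (e x - tiltedRows q T (Function.update θ (i, j) t) i j) ^ 2) ∂cosPrior r := by
  set M : ℝ → α → α → ℝ := fun t => tiltedRows q T (Function.update θ (i, j) t)
  have mem_box : ∀ t ∈ Set.Icc (-r) r, ∀ c, Function.update θ (i, j) t c ∈ Set.Icc (-r) r :=
    fun t ht c => by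
      rw [Function.update_apply]
      split_ifs
      exacts [ht, hθ c]
  have law : ∀ t ∈ Set.Icc (-r) r, IsChainLaw q (M t) := fun t ht =>
    isChainLaw_tiltedRows hq hqr (mem_box t ht)
  have near : ∀ t ∈ Set.Icc (-r) r, ∀ a l, |M t a l - q l| ≤ 2 * r := fun t ht =>
    abs_tiltedRows_sub_le (mem_box t ht)
  have entry_ne : ∀ t ∈ Set.Icc (-r) r, ∀ a l, M t a l ≠ 0 := fun t ht a l =>
    ne_of_gt (by linarith [hqr l, (abs_le.1 (near t ht a l)).1])
  have centred_nonneg : 0 ≤ 1 - 1 / (T.card : ℝ) := by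
    rw [← sum_centredIndicator_sq hj]
    positivity
  refine vanTrees_pathMean (i := i) (σ := fun t l => centredIndicator T j l / M t i l) hr law
    (fun t ht a l => ?_) (fun t ht => ?_) (fun t ht => ?_) (fun t _ => ?_) e
  · refine (hasDerivAt_tiltedRows θ i hj a l t).congr_deriv ?_
    by_cases ha : a = i
    · rw [if_pos ha, if_pos ha, ha, mul_div_cancel₀ _ (entry_ne t ht i l)]
    · rw [if_neg ha, if_neg ha, mul_zero]
  · simp only [mul_div_cancel₀ _ (entry_ne t ht i _), sum_centredIndicator hj]
  · refine mul_le_mul (sum_mul_sq_centredIndicator_div_le (by linarith) (fun l hl => ?_) hj)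
      (pathMean_successorSum_one_le (law t ht) (by linarith) fun a => ?_)
      ((law t ht).pathMean_nonneg fun x => ?_) (div_nonneg centred_nonneg (by linarith))
    · linarith [hb l hl, (abs_le.1 (near t ht i l)).1]
    · linarith [(abs_le.1 (near t ht a i)).2]
    · exact Finset.sum_nonneg fun s _ => by split_ifs <;> simp
  · simpa only [if_true, centredIndicator_self hj] using
      hasDerivAt_tiltedRows (q := q) θ i hj i j t

theorem exists_tiltedRows_sum_pathMean_ge (hr : 0 < r) (hq : ∑ j, q j = 1)
    (hqr : ∀ j, 2 * r < q j) (hbr : 2 * r < b) (hb : ∀ l ∈ T, b ≤ q l) (A : Finset α)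
    (e : (Fin (m + 1) → α) → α → α → ℝ) :
    ∃ θ : α × α → ℝ, (∀ c, θ c ∈ Set.Icc (-r) r) ∧
      ∑ i ∈ A, T.card * ((1 - 1 / (T.card : ℝ)) ^ 2 /
        ((1 - 1 / (T.card : ℝ)) / (b - 2 * r) * (m * (q i + 2 * r)) + Real.pi ^ 2 / r ^ 2)) ≤
      ∑ i ∈ A, ∑ j ∈ T, pathMean q (tiltedRows q T θ)
        fun x => (e x i j - tiltedRows q T θ i j) ^ 2 := by
  obtain ⟨θ, hθ, risk_ge⟩ := exists_mem_Icc_sum_le_of_cosPrior hr (A ×ˢ T)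
    (R := fun c θ => pathMean q (tiltedRows q T θ)
      fun x => (e x c.1 c.2 - tiltedRows q T θ c.1 c.2) ^ 2)
    (fun c _ => continuous_pathMean_tiltedRows (fun x => e x c.1 c.2) c.1 c.2)
    (fun c hc θ hθ => le_integral_pathMean_tiltedRows_update hr hq hqr hbr hb hθ c.1
      (Finset.mem_product.1 hc).2 fun x => e x c.1 c.2)
  refine ⟨θ, hθ, ?_⟩
  simpa only [Finset.sum_product, Finset.sum_const, nsmul_eq_mul] using risk_ge

end TiltedRows

section LocalMinimax

variable {α : Type*} {q : α → ℝ} {T A : Finset α} {b c : ℝ}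

theorem tendsto_add_one_mul_div_mul_add {a : ℝ} (ha : a ≠ 0) (c d : ℝ) :
    Tendsto (fun m : ℕ => ((m : ℝ) + 1) * (c / (m * a + d))) atTop (𝓝 (c / a)) := by
  have lim : Tendsto (fun m : ℕ => c / (a + (d - a) * (1 / ((m : ℝ) + 1)))) atTop
      (𝓝 (c / (a + (d - a) * 0))) :=
    tendsto_const_nhds.div ((tendsto_one_div_add_atTop_nhds_zero_nat.const_mul _).const_add _)
      (by simpa using ha)
  rw [mul_zero, add_zero] at lim
  refine lim.congr fun m => ?_
  have denominator : a + (d - a) * (1 / ((m : ℝ) + 1)) = (m * a + d) / (m + 1) := by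
    field_simp
    ring
  rw [denominator, div_div_eq_mul_div, mul_comm c, mul_div_assoc]

theorem exists_radius_lt_sum [Finite α] (hT : 2 ≤ T.card) (hq : ∀ j, 0 < q j) (hb : 0 < b)
    (hc : c < ∑ i ∈ A, (T.card - 1) * b / q i) {ε : ℝ} (hε : 0 < ε) :
    ∃ r : ℝ, 0 < r ∧ 2 * r < b ∧ (∀ j, 2 * r < q j) ∧ 2 * r < ε ∧
      c < ∑ i ∈ A, T.card * ((1 - 1 / (T.card : ℝ)) ^ 2 /
        ((1 - 1 / (T.card : ℝ)) / (b - 2 * r) * (q i + 2 * r))) := by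
  have card_ge : (2 : ℝ) ≤ T.card := by exact_mod_cast hT
  set d : ℝ := 1 - 1 / (T.card : ℝ) with hd
  have d_pos : 0 < d := by rw [hd, sub_pos, div_lt_one] <;> linarith
  have card_mul : T.card * d = T.card - 1 := by
    rw [hd]
    field_simp
  have limit : ContinuousAt (fun r : ℝ => ∑ i ∈ A, T.card * (d ^ 2 /
      (d / (b - 2 * r) * (q i + 2 * r)))) 0 := by
    refine tendsto_finsetSum _ fun i _ => ?_
    have b_ne : b - 2 * 0 ≠ 0 := by simpa using hb.ne'
    have information_ne : d / (b - 2 * 0) * (q i + 2 * 0) ≠ 0 :=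
      mul_ne_zero (div_ne_zero d_pos.ne' b_ne) (by simpa using (hq i).ne')
    have information : ContinuousAt (fun r : ℝ => d / (b - 2 * r) * (q i + 2 * r)) 0 := by
      fun_prop (disch := exact b_ne)
    exact continuousAt_const.mul (continuousAt_const.div information information_ne)
  have double : ContinuousAt (fun r : ℝ => 2 * r) 0 := by fun_prop
  have small : ∀ {a : ℝ}, 0 < a → ∀ᶠ r : ℝ in 𝓝 0, 2 * r < a := fun ha =>
    double.eventually_lt_const (by simpa using ha)
  have near := (small hb).and ((eventually_all.2 fun j => small (hq j)).and ((small hε).and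
    (limit.eventually_const_lt (show c < _ from hc.trans_eq (Finset.sum_congr rfl fun i _ => by
      rw [← card_mul, mul_zero, sub_zero, add_zero]
      field_simp)))))
  obtain ⟨r, hr, hrest⟩ := ((eventually_mem_nhdsWithin (s := Set.Ioi (0 : ℝ))).and
    (near.filter_mono nhdsWithin_le_nhds)).exists
  exact ⟨r, hr, hrest⟩

theorem eventually_exists_isChainLaw_sum_pathMean_ge [Fintype α] (hT : 2 ≤ T.card)
    (hq : ∀ j, 0 < q j) (hq1 : ∑ j, q j = 1) (hb0 : 0 < b) (hb : ∀ l ∈ T, b ≤ q l)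
    (hc : c < ∑ i ∈ A, (T.card - 1) * b / q i) {ε : ℝ} (hε : 0 < ε) :
    ∀ᶠ m : ℕ in atTop, ∀ e : (Fin (m + 1) → α) → α → α → ℝ, ∃ M : α → α → ℝ,
      IsChainLaw q M ∧ (∀ i j, |M i j - q j| ≤ ε) ∧ (∀ i, ∀ j ∉ T, M i j = q j) ∧
      c / (m + 1) ≤ ∑ i ∈ A, ∑ j ∈ T, pathMean q M fun x => (e x i j - M i j) ^ 2 := by
  classical
  obtain ⟨r, hr, hbr, hqr, hrε, hcr⟩ := exists_radius_lt_sum hT hq hb0 hc hε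
  have card_ge : (2 : ℝ) ≤ T.card := by exact_mod_cast hT
  have information_ne : ∀ i, (1 - 1 / (T.card : ℝ)) / (b - 2 * r) * (q i + 2 * r) ≠ 0 := by
    intro i
    have := hq i
    have : (0 : ℝ) < 1 - 1 / T.card := by rw [sub_pos, div_lt_one] <;> linarith
    have : 0 < b - 2 * r := by linarith
    positivity
  have limit := tendsto_finsetSum A fun i _ =>
    (tendsto_add_one_mul_div_mul_add (information_ne i) ((1 - 1 / (T.card : ℝ)) ^ 2)
      (Real.pi ^ 2 / r ^ 2)).const_mul (T.card : ℝ)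
  filter_upwards [limit.eventually_const_lt hcr] with m hm e
  obtain ⟨θ, hθ, risk_ge⟩ := exists_tiltedRows_sum_pathMean_ge hr hq1 hqr hbr hb A e
  refine ⟨tiltedRows q T θ, isChainLaw_tiltedRows hq1 hqr hθ,
    fun i j => (abs_tiltedRows_sub_le hθ i j).trans hrε.le,
    fun i j hj => tiltedRows_of_notMem θ i hj, le_trans ?_ risk_ge⟩
  rw [div_le_iff₀' (by positivity), Finset.mul_sum]
  refine hm.le.trans_eq (Finset.sum_congr rfl fun i _ => ?_)
  ring

end LocalMinimax

section Asymptotics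

theorem AsympLE.of_forall_pos {a b : ℕ → ℝ} (hb : ∀ᶠ n in atTop, 0 < b n)
    (h : ∀ ε > 0, ∀ᶠ n in atTop, a n ≤ b n * (1 + ε)) : AsympLE a b := by
  refine ⟨fun n => max (a n / b n - 1) 0, Metric.tendsto_nhds.2 fun ε hε => ?_, ?_⟩
  · filter_upwards [hb, h (ε / 2) (by positivity)] with n hbn hn
    have excess_le : a n / b n - 1 ≤ ε / 2 := by
      rw [sub_le_iff_le_add', div_le_iff₀' hbn]
      exact hn
    rw [Real.dist_0_eq_abs, abs_of_nonneg (le_max_right _ _)]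
    exact (max_le excess_le (by positivity)).trans_lt (by linarith)
  · filter_upwards [hb] with n hbn
    rw [← div_le_iff₀' hbn]
    linarith [le_max_left (a n / b n - 1) 0]

theorem AsympLE.div_of_forall_lt {C : ℝ} (hC : 0 < C) {a : ℕ → ℝ}
    (h : ∀ c < C, ∀ᶠ n : ℕ in atTop, c / n ≤ a n) : AsympLE (fun n => C / n) a := by
  refine AsympLE.of_forall_pos ?_ fun ε hε => ?_
  · filter_upwards [h (C / 2) (by linarith), eventually_gt_atTop 0] with n hn hn0
    exact lt_of_lt_of_le (by positivity) hn
  · filter_upwards [h (C / (1 + ε)) (div_lt_self hC (by linarith))] with n hn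
    rwa [div_right_comm, div_le_iff₀ (by positivity)] at hn

theorem AsympLE.div_of_forall_gt {C : ℝ} (hC : 0 < C) {a : ℕ → ℝ}
    (h : ∀ c > C, ∀ᶠ n : ℕ in atTop, a n ≤ c / n) : AsympLE a (fun n => C / n) := by
  refine AsympLE.of_forall_pos ?_ fun ε hε => ?_
  · filter_upwards [eventually_gt_atTop 0] with n hn
    positivity
  · filter_upwards [h (C * (1 + ε)) (lt_mul_of_one_lt_right hC (by linarith))] with n hn
    rwa [mul_div_right_comm] at hn

theorem AsympLE.of_le {a b : ℕ → ℝ} (h : ∀ᶠ n in atTop, a n ≤ b n) : AsympLE a b :=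
  ⟨0, tendsto_const_nhds, by simpa using h⟩

theorem AsympLE.trans_le_left {a a' b : ℕ → ℝ} (ha : ∀ n, a' n ≤ a n) (h : AsympLE a b) :
    AsympLE a' b := by
  obtain ⟨e, he, hle⟩ := h
  exact ⟨e, he, hle.mono fun n hn => (ha n).trans hn⟩

end Asymptotics

section Risks

variable {k n : ℕ}

theorem MarkovChain.pathProb_mem (C : MarkovChain k) :
    (C.pathProb : (Fin n → Fin k) → ℝ) ∈ stdSimplex ℝ (Fin n → Fin k) := by
  cases n with
  | zero => exact ⟨fun _ => zero_le_one, by simp [MarkovChain.pathProb]⟩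
  | succ m => exact C.isChainLaw.pathWeight_mem

theorem stateRisk_mem_Icc (C : MarkovChain k) (E : Estimator k n) (i : Fin k) :
    stateRisk C E i ∈ Set.Icc 0 2 :=
  ⟨le_sum_mul_of_mem_stdSimplex C.pathProb_mem fun _ => lossL2_nonneg _ _,
    sum_mul_le_of_mem_stdSimplex C.pathProb_mem fun _ => lossL2_le_two _ _⟩

theorem stateRisk_le_maxRisk (C : MarkovChain k) (E : Estimator k n) (i : Fin k) :
    stateRisk C E i ≤ maxRisk C E :=
  le_ciSup (f := stateRisk C E) (Set.finite_range _).bddAbove i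

theorem maxRisk_mem_Icc (C : MarkovChain k) (E : Estimator k n) : maxRisk C E ∈ Set.Icc 0 2 :=
  ⟨Real.iSup_nonneg fun i => (stateRisk_mem_Icc C E i).1,
    Real.iSup_le (fun i => (stateRisk_mem_Icc C E i).2) zero_le_two⟩

theorem weightedRisk_mem_Icc (C : MarkovChain k) (E : Estimator k n) :
    weightedRisk C E ∈ Set.Icc 0 2 :=
  ⟨le_sum_mul_of_mem_stdSimplex C.stationary_spec.1 fun i => (stateRisk_mem_Icc C E i).1,
    sum_mul_le_of_mem_stdSimplex C.stationary_spec.1 fun i => (stateRisk_mem_Icc C E i).2⟩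

theorem mul_sum_stateRisk_le_weightedRisk {γ : ℝ} {C : MarkovChain k} (hC : C ∈ chainsAbove k γ)
    (E : Estimator k n) : γ * ∑ i, stateRisk C E i ≤ weightedRisk C E := by
  rw [Finset.mul_sum]
  exact Finset.sum_le_sum fun i _ => mul_le_mul_of_nonneg_right
    (C.le_stationary fun a => hC a i) (stateRisk_mem_Icc C E i).1

variable {R : MarkovChain k → Estimator k n → ℝ} {S : Set (MarkovChain k)}

theorem minimaxRisk_le_worstCaseRisk (hR : ∀ C E, 0 ≤ R C E) (E : Estimator k n) :
    minimaxRisk R S ≤ worstCaseRisk R S E :=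
  ciInf_le (f := worstCaseRisk R S)
    ⟨0, Set.forall_mem_range.2 fun E => Real.iSup_nonneg fun C => hR C E⟩ E

theorem le_minimaxRisk {B L : ℝ} (hR : ∀ C E, R C E ≤ B) (h : ∀ E, ∃ C ∈ S, L ≤ R C E) :
    L ≤ minimaxRisk R S := by
  have : Nonempty (Estimator k n) := ⟨addSqrtEstimator k n⟩
  refine le_ciInf fun E => ?_
  obtain ⟨C, hC, hL⟩ := h E
  exact hL.trans (le_ciSup (f := fun C : S => R C E)
    ⟨B, Set.forall_mem_range.2 fun C => hR C E⟩ ⟨C, hC⟩)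

end Risks

section UpperBound

variable {k : ℕ} {δ c : ℝ}

theorem eventually_worstCaseRisk_weightedRisk_le (hk : 0 < k) (hδ : 0 < δ)
    (hc : (k : ℝ) - 1 < c) : ∀ᶠ n : ℕ in atTop,
      worstCaseRisk weightedRisk (chainsAbove k δ) (addSqrtEstimator k n) ≤ c / n := by
  have hk1 : (1 : ℝ) ≤ k := by exact_mod_cast hk
  have row_lt : 1 - 1 / (k : ℝ) < c / k := by
    rw [one_sub_div (by positivity)]
    gcongr
  filter_upwards [eventually_stationary_mul_stateRisk_addSqrtEstimator_le hδ row_lt] with n hn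
  refine Real.iSup_le (fun C => ?_) (div_nonneg (by linarith) n.cast_nonneg)
  calc weightedRisk C.1 (addSqrtEstimator k n) ≤ ∑ _i : Fin k, c / k / n :=
        Finset.sum_le_sum fun i _ => hn C.1 C.2 i
    _ = c / n := by
        rw [Finset.sum_const, Finset.card_univ, Fintype.card_fin, nsmul_eq_mul]
        field_simp

theorem eventually_worstCaseRisk_maxRisk_le (hk : 0 < k) (hδ : 0 < δ)
    (hc : (1 - 1 / (k : ℝ)) / δ < c) : ∀ᶠ n : ℕ in atTop,
      worstCaseRisk maxRisk (chainsAbove k δ) (addSqrtEstimator k n) ≤ c / n := by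
  have limit_nonneg : 0 ≤ (1 - 1 / (k : ℝ)) / δ :=
    div_nonneg (sub_nonneg.2 (div_le_one_of_le₀ (by exact_mod_cast hk) k.cast_nonneg)) hδ.le
  have bound_nonneg (n : ℕ) : 0 ≤ c / n := div_nonneg (limit_nonneg.trans hc.le) n.cast_nonneg
  rw [div_lt_iff₀ hδ] at hc
  filter_upwards [eventually_stationary_mul_stateRisk_addSqrtEstimator_le hδ hc] with n hn
  refine Real.iSup_le (fun C => Real.iSup_le (fun i => ?_) (bound_nonneg n)) (bound_nonneg n)
  have weighted_le : δ * stateRisk C.1 (addSqrtEstimator k n) i ≤ c * δ / n :=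
    (mul_le_mul_of_nonneg_right (C.1.le_stationary fun a => C.2 a i)
      (stateRisk_mem_Icc C.1 _ i).1).trans (hn C.1 C.2 i)
  rwa [mul_comm c, mul_div_assoc, mul_le_mul_iff_right₀ hδ] at weighted_le

theorem asympLE_worstCaseRisk_weightedRisk (hk : 2 ≤ k) (hδ : 0 < δ) :
    AsympLE (fun n => worstCaseRisk weightedRisk (chainsAbove k δ) (addSqrtEstimator k n))
      (fun n => ((k : ℝ) - 1) / n) :=
  AsympLE.div_of_forall_gt (sub_pos.2 (by exact_mod_cast hk))
    fun _ hc => eventually_worstCaseRisk_weightedRisk_le (by omega) hδ hc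

theorem asympLE_worstCaseRisk_maxRisk (hk : 2 ≤ k) (hδ : 0 < δ) :
    AsympLE (fun n => worstCaseRisk maxRisk (chainsAbove k δ) (addSqrtEstimator k n))
      (fun n => (1 - 1 / (k : ℝ)) / (n * δ)) := by
  have one_lt : (1 : ℝ) < k := by exact_mod_cast hk
  have constant_pos : 0 < (1 - 1 / (k : ℝ)) / δ :=
    div_pos (sub_pos.2 ((div_lt_one (by linarith)).2 one_lt)) hδ
  simp only [mul_comm _ δ, ← div_div]
  exact AsympLE.div_of_forall_gt constant_pos
    fun _ hc => eventually_worstCaseRisk_maxRisk_le (by omega) hδ hc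

end UpperBound

section LowerBound

variable {k : ℕ} {δ c : ℝ} {q : Fin k → ℝ} {M : Fin k → Fin k → ℝ}

/-- The Markov chain whose initial distribution and transition matrix are given by `q` and `M`,
used to read bounds on `pathMean q M` as bounds on the risks of an estimator. -/
def IsChainLaw.toMarkovChain (h : IsChainLaw q M) : MarkovChain k where
  init := ⟨q, h.init_mem⟩
  trans i := ⟨M i, h.row_mem i⟩

theorem IsChainLaw.stateRisk_toMarkovChain (h : IsChainLaw q M) {m : ℕ}
    (E : Estimator k (m + 1)) (i : Fin k) :
    stateRisk h.toMarkovChain E i = ∑ j, pathMean q M fun x => (E x i j - M i j) ^ 2 := by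
  rw [← pathMean_sum]
  change (pathMean q M fun x => ∑ j, (M i j - E x i j) ^ 2) = _
  simp only [sub_sq_comm]

theorem eventually_le_minimaxRisk_weightedRisk (hk : 2 ≤ k) (hδ : δ < 1 / (k : ℝ))
    (hc : c < k - 1) :
    ∀ᶠ n : ℕ in atTop, c / n ≤ minimaxRisk (n := n) weightedRisk (chainsAbove k δ) := by
  have hk2 : (2 : ℝ) ≤ k := by exact_mod_cast hk
  have hk0 : (0 : ℝ) < k := by linarith
  have uniform_sum : ∑ _j : Fin k, 1 / (k : ℝ) = 1 := by
    simp [hk0.ne']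
  obtain ⟨c', c'_gt, c'_lt⟩ : ∃ c', max (k * c) 0 < c' ∧ c' < k * (k - 1) :=
    exists_between (max_lt (mul_lt_mul_of_pos_left hc hk0) (mul_pos hk0 (by linarith)))
  obtain ⟨mul_lt, c'_pos⟩ := max_lt_iff.1 c'_gt
  set γ := max δ (max 0 (c / c'))
  have γ_lt : γ < 1 / k := max_lt hδ (max_lt (one_div_pos.2 hk0) (by
    rwa [div_lt_div_iff₀ c'_pos hk0, one_mul, mul_comm]))
  have γ_nonneg : 0 ≤ γ := (le_max_left _ _).trans (le_max_right _ _)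
  have local_bound := eventually_exists_isChainLaw_sum_pathMean_ge (c := c')
    (T := Finset.univ) (A := Finset.univ) (q := fun _ : Fin k => 1 / (k : ℝ)) (by simpa using hk)
    (fun _ => one_div_pos.2 hk0) uniform_sum (one_div_pos.2 hk0) (fun _ _ => le_rfl)
    (by simpa [hk0.ne', mul_sub] using c'_lt) (sub_pos.2 γ_lt)
  rw [← map_add_atTop_eq_nat 1, eventually_map]
  filter_upwards [local_bound] with m hm
  refine le_minimaxRisk (fun C E => (weightedRisk_mem_Icc C E).2) fun E => ?_
  obtain ⟨M, law, near, -, risk_ge⟩ := hm fun x i j => E x i j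
  have above : law.toMarkovChain ∈ chainsAbove k γ := fun i j => by
    linarith [neg_le_of_abs_le (near i j), show law.toMarkovChain.trans i j = M i j from rfl]
  refine ⟨law.toMarkovChain, fun i j => (le_max_left _ _).trans (above i j), ?_⟩
  push_cast
  calc c / ((m : ℝ) + 1) ≤ γ * (c' / (m + 1)) := by
        rw [← mul_div_assoc]
        gcongr
        exact (div_le_iff₀ c'_pos).1 ((le_max_right _ _).trans (le_max_right _ _))
    _ ≤ γ * ∑ i, stateRisk law.toMarkovChain E i := by
        simp only [law.stateRisk_toMarkovChain]
        exact mul_le_mul_of_nonneg_left risk_ge γ_nonneg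
    _ ≤ weightedRisk law.toMarkovChain E := mul_sum_stateRisk_le_weightedRisk above E

/-- The distribution on `k` points that gives mass `δ` to `i₀` and spreads the rest evenly. A chain
with rows close to it rarely visits `i₀`, which makes the row of `i₀` hard to estimate. -/
noncomputable def rareStateRow (δ : ℝ) (i₀ j : Fin k) : ℝ :=
  if j = i₀ then δ else (1 - δ) / ((k : ℝ) - 1)

theorem rareStateRow_self (δ : ℝ) (i₀ : Fin k) : rareStateRow δ i₀ i₀ = δ :=
  if_pos rfl

theorem rareStateRow_of_ne (δ : ℝ) {i₀ j : Fin k} (hj : j ≠ i₀) :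
    rareStateRow δ i₀ j = (1 - δ) / ((k : ℝ) - 1) :=
  if_neg hj

theorem card_univ_erase_cast (i₀ : Fin k) : ((Finset.univ.erase i₀).card : ℝ) = k - 1 := by
  rw [Finset.card_erase_of_mem (Finset.mem_univ i₀), Finset.card_univ, Fintype.card_fin,
    Nat.cast_pred i₀.pos]

theorem sum_rareStateRow (hk : 2 ≤ k) (i₀ : Fin k) : ∑ j, rareStateRow δ i₀ j = 1 := by
  have hk2 : (2 : ℝ) ≤ k := by exact_mod_cast hk
  have card_ne : (k : ℝ) - 1 ≠ 0 := by linarith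
  rw [← Finset.add_sum_erase _ _ (Finset.mem_univ i₀), rareStateRow_self,
    Finset.sum_congr rfl fun j hj => rareStateRow_of_ne δ (Finset.ne_of_mem_erase hj),
    Finset.sum_const, nsmul_eq_mul, card_univ_erase_cast, mul_div_cancel₀ _ card_ne,
    add_sub_cancel]

theorem lt_one_sub_div_sub_one (hk : 2 ≤ k) (hδ : δ < 1 / (k : ℝ)) :
    δ < (1 - δ) / ((k : ℝ) - 1) := by
  have hk2 : (2 : ℝ) ≤ k := by exact_mod_cast hk
  rw [lt_div_iff₀ (by linarith)] at hδ ⊢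
  linarith

theorem eventually_le_minimaxRisk_maxRisk (hk : 3 ≤ k) (hδ0 : 0 < δ) (hδ1 : δ < 1 / (k : ℝ))
    (hc : c < (1 - δ) * (1 - 1 / ((k : ℝ) - 1)) / δ) :
    ∀ᶠ n : ℕ in atTop, c / n ≤ minimaxRisk (n := n) maxRisk (chainsAbove k δ) := by
  have hk3 : (3 : ℝ) ≤ k := by exact_mod_cast hk
  have hk1 : (0 : ℝ) < (k : ℝ) - 1 := by linarith
  let i₀ : Fin k := ⟨0, by omega⟩
  have δ_lt := lt_one_sub_div_sub_one (by omega) hδ1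
  have information_lt : c < ∑ i ∈ {i₀}, ((Finset.univ.erase i₀).card - 1) *
      ((1 - δ) / ((k : ℝ) - 1)) / rareStateRow δ i₀ i := by
    rw [Finset.sum_singleton, rareStateRow_self, card_univ_erase_cast]
    refine hc.trans_eq ?_
    field_simp
  have local_bound := eventually_exists_isChainLaw_sum_pathMean_ge
    (by rw [← Nat.cast_le (α := ℝ), card_univ_erase_cast]; push_cast; linarith)
    (fun j => by unfold rareStateRow; split_ifs <;> linarith)
    (sum_rareStateRow (by omega) i₀) (hδ0.trans δ_lt)
    (fun j hj => (rareStateRow_of_ne δ (Finset.ne_of_mem_erase hj)).ge)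
    information_lt (sub_pos.2 δ_lt)
  rw [← map_add_atTop_eq_nat 1, eventually_map]
  filter_upwards [local_bound] with m hm
  refine le_minimaxRisk (fun C E => (maxRisk_mem_Icc C E).2) fun E => ?_
  obtain ⟨M, law, near, off, risk_ge⟩ := hm fun x i j => E x i j
  refine ⟨law.toMarkovChain, fun i j => ?_, ?_⟩
  · change δ ≤ M i j
    rcases eq_or_ne j i₀ with rfl | hj
    · rw [off i i₀ (Finset.notMem_erase _ _), rareStateRow_self]
    · linarith [neg_le_of_abs_le (near i j), rareStateRow_of_ne δ hj]
  · rw [Finset.sum_singleton] at risk_ge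
    push_cast
    refine (risk_ge.trans ?_).trans (stateRisk_le_maxRisk _ E i₀)
    rw [law.stateRisk_toMarkovChain]
    exact Finset.sum_le_sum_of_subset_of_nonneg (Finset.subset_univ _) fun j _ _ =>
      law.pathMean_nonneg fun _ => sq_nonneg _

theorem asympLE_minimaxRisk_weightedRisk (hk : 2 ≤ k) (hδ : δ < 1 / (k : ℝ)) :
    AsympLE (fun n => ((k : ℝ) - 1) / n)
      (fun n => minimaxRisk (n := n) weightedRisk (chainsAbove k δ)) :=
  AsympLE.div_of_forall_lt (sub_pos.2 (by exact_mod_cast hk))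
    fun _ hc => eventually_le_minimaxRisk_weightedRisk hk hδ hc

theorem asympLE_minimaxRisk_maxRisk (hk : 2 ≤ k) (hδ0 : 0 < δ) (hδ1 : δ < 1 / (k : ℝ)) :
    AsympLE (fun n => (1 - δ) ^ 2 * ((1 - 1 / ((k : ℝ) - 1)) / (n * δ)))
      (fun n => minimaxRisk (n := n) maxRisk (chainsAbove k δ)) := by
  refine AsympLE.of_le ?_
  rcases hk.eq_or_lt with rfl | hk3
  · have factor_eq : (1 : ℝ) - 1 / (((2 : ℕ) : ℝ) - 1) = 0 := by norm_num
    refine Eventually.of_forall fun n => ?_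
    rw [factor_eq, zero_div, mul_zero]
    exact Real.iInf_nonneg fun E => Real.iSup_nonneg fun C => (maxRisk_mem_Icc _ E).1
  · have hk3' : (3 : ℝ) ≤ k := by exact_mod_cast hk3
    have δ_lt_one : δ < 1 := hδ1.trans ((div_lt_one (by linarith)).2 (by linarith))
    have factor_pos : 0 < 1 - 1 / ((k : ℝ) - 1) := by
      rw [sub_pos, div_lt_one] <;> linarith
    have constant_lt : (1 - δ) ^ 2 * (1 - 1 / ((k : ℝ) - 1)) / δ <
        (1 - δ) * (1 - 1 / ((k : ℝ) - 1)) / δ := by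
      gcongr
      nlinarith
    filter_upwards [eventually_le_minimaxRisk_maxRisk hk3 hδ0 hδ1 constant_lt] with n hn
    rwa [← mul_div_assoc, mul_comm (n : ℝ), ← div_div]

end LowerBound

theorem theorem4 (k : ℕ) (hk : 2 ≤ k) (δ : ℝ) (hδ0 : 0 < δ) (hδ1 : δ < 1 / (k : ℝ)) :
    -- the stationary-weighted minimax risk
    AsympEq (fun n => minimaxRisk (n := n) weightedRisk (chainsAbove k δ))
      (fun n => ((k : ℝ) - 1) / n) ∧
    -- the worst-state minimax risk
    AsympLE (fun n => (1 - δ) ^ 2 * ((1 - 1 / ((k : ℝ) - 1)) / (n * δ)))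
      (fun n => minimaxRisk (n := n) maxRisk (chainsAbove k δ)) ∧
    AsympLE (fun n => minimaxRisk (n := n) maxRisk (chainsAbove k δ))
      (fun n => (1 - 1 / (k : ℝ)) / (n * δ)) ∧
    -- both upper bounds are met by the add-`√N_i / k` estimator
    AsympLE (fun n => worstCaseRisk weightedRisk (chainsAbove k δ) (addSqrtEstimator k n))
      (fun n => ((k : ℝ) - 1) / n) ∧
    AsympLE (fun n => worstCaseRisk maxRisk (chainsAbove k δ) (addSqrtEstimator k n))
      (fun n => (1 - 1 / (k : ℝ)) / (n * δ)) := by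
  have weighted_upper := asympLE_worstCaseRisk_weightedRisk hk hδ0
  have max_upper := asympLE_worstCaseRisk_maxRisk hk hδ0
  have weighted_lower := asympLE_minimaxRisk_weightedRisk hk hδ1
  have max_lower := asympLE_minimaxRisk_maxRisk hk hδ0 hδ1
  have weighted_le (n : ℕ) := minimaxRisk_le_worstCaseRisk (S := chainsAbove k δ)
    (fun C E => (weightedRisk_mem_Icc C E).1) (addSqrtEstimator k n)
  have max_le (n : ℕ) := minimaxRisk_le_worstCaseRisk (S := chainsAbove k δ)
    (fun C E => (maxRisk_mem_Icc C E).1) (addSqrtEstimator k n)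
  exact ⟨⟨weighted_upper.trans_le_left weighted_le, weighted_lower⟩, max_lower,
    max_upper.trans_le_left max_le, weighted_upper, max_upper⟩
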